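/- Let $\hat g(\omega)=\int_{\mathbb R} g(x)e^{i\omega x}\,dx$. One observes $Y_j=X_j+\zeta_j$, $j=1,\dots,n$, where $X_1,\dots,X_n$ are i.i.d. with unknown distribution function $F$, and $\zeta_1,\dots,\zeta_n$ are i.i.d., independent of the $X_j$, with a known density $f_\zeta$ with respect to Lebesgue measure on $\mathbb R$. For $\alpha>-1/2$ and $L>0$ let $\mathcal F_\alpha(L)$ be the class of distributions having a density $f$ with $$\frac1{2\pi}\int_{-\infty}^{\infty}|\hat f(\omega)|^2(1+\omega^2)^\alpha\,d\omega\le L^2 .$$ For an estimator $\tilde F=\tilde F(Y_1,\dots,Y_n)$ of $F(t_0)$ and $\epsilon\in(0,1/2)$ put $$\mathrm{Risk}_2[\tilde F;\mathcal F]=\sup_{F\in\mathcal F}\{\mathbb E|\tilde F-F(t_0)|^2\}^{1/2},\qquad \mathrm{Risk}_\epsilon[\tilde F;\mathcal F]=\min\Bigl\{\delta:\sup_{F\in\mathcal F}\mathbb P[|\tilde F-F(t_0)|>\delta]\le\epsilon\Bigr\}.$$ For $\lambda>0$ let $$\tilde F_\lambda=\frac12-\frac1n\sum_{j=1}^n\frac1\pi\int_0^\lambda\frac1\omega\,\mathrm{Im}\Bigl\{\frac{e^{i\omega(Y_j-t_0)}}{\hat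 f_\zeta(\omega)}\Bigr\}d\omega ,$$ and for $z\ge1$ let $\lambda(z)=z^{1/[2\alpha+\max(2\beta,1)]}$ and $$\psi(z)=\begin{cases}z^{-(2\alpha+1)/(4\alpha+4\beta)},&\beta>1/2,\\ \sqrt{\ln z/z},&\beta=1/2,\\ 1/\sqrt z,&0<\beta<1/2.\end{cases}$$ **Theorem.** Let $\alpha>-1/2$, $\beta>0$, $\alpha+\beta>1/2$, and let $L,c_\zeta,C_\zeta,\omega_0,b_\zeta,\tau>0$. There are constants $C_1,C_2,C_3>0$, $C_4\in(0,1]$ and $n_0\in\mathbb N$, depending only on these parameters, such that the following holds for every error density $f_\zeta$ satisfying (E1) $c_\zeta(1+\omega^2)^{-\beta/2}\le|\hat f_\zeta(\omega)|\le C_\zeta(1+\omega^2)^{-\beta/2}$ for all $\omega\in\mathbb R$, and (E2) $|\hat f_\zeta(\omega)|\ge1-b_\zeta|\omega|^\tau$ for all $|\omega|\le\omega_0$, and for every $t_0\in\mathbb R$. The integrals defining $\tilde F_\lambda$ converge absolutely for all $\lambda>0$, and for all $n\ge n_0$: 1. if $\lambda_\star=C_1\lambda(n)$, then $\mathrm{Risk}_2[\tilde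 F_{\lambda_\star};\mathcal F_\alpha(L)]\le C_2\,\psi(n)$; 2. for every $\epsilon\in(0,1/2)$ with $\epsilon\ge2\exp\{-C_4n\}$, if $\lambda_\star=C_1\lambda(n/\ln(2/\epsilon))$, then $\mathrm{Risk}_\epsilon[\tilde F_{\lambda_\star};\mathcal F_\alpha(L)]\le C_3\,\psi(n/\ln(2/\epsilon))$. -/

import Mathlib

open MeasureTheory ProbabilityTheory
open scoped ENNReal

noncomputable section

namespace Deconvolution

/-- `f` is a probability density on the real line with respect to Lebesgue measure. -/
structure IsProbDensity (f : ℝ → ℝ) : Prop where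
  measurable : Measurable f
  nonneg : ∀ x, 0 ≤ f x
  lintegral_eq_one : ∫⁻ x, ENNReal.ofReal (f x) = 1

/-- The distribution with density `f`. -/
def densityLaw (f : ℝ → ℝ) : Measure ℝ :=
  volume.withDensity fun x => ENNReal.ofReal (f x)

/-- The Fourier transform `ĝ(ω) = ∫ g(x) e^{iωx} dx`. -/
def fourierTr (g : ℝ → ℝ) (ω : ℝ) : ℂ :=
  ∫ x : ℝ, (g x : ℂ) * Complex.exp (Complex.I * (ω : ℂ) * (x : ℂ))

/-- The Sobolev class of distributions: those with a density `f` such that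
`(2π)⁻¹ ∫ |f̂(ω)|² (1 + ω²)^α dω ≤ L²`. The integral is a `[0, ∞]`-valued one, so the condition
includes its convergence. A distribution function `F` is represented by its probability
measure `μ`, and `F t = cdf μ t`. -/
def sobolevClass (α L : ℝ) : Set (Measure ℝ) :=
  {μ | ∃ f : ℝ → ℝ, IsProbDensity f ∧ μ = densityLaw f ∧
    ENNReal.ofReal (1 / (2 * Real.pi)) *
        ∫⁻ ω : ℝ, ENNReal.ofReal (‖fourierTr f ω‖ ^ 2 * (1 + ω ^ 2) ^ α)
      ≤ ENNReal.ofReal (L ^ 2)}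

/-- The law of `Yⁿ = (Y₁, …, Yₙ)` with `Y_j = X_j + ζ_j`, where `X_j` has law `μ`, `ζ_j` has law
`ν` and all these variables are independent: the `n`-fold product of the convolution `μ ∗ ν`. -/
def obsLaw (μ ν : Measure ℝ) (n : ℕ) : Measure (Fin n → ℝ) :=
  Measure.pi fun _ => Measure.conv μ ν

/-- Maximal quadratic risk `sup_F {E |F̃ - F(t₀)|²}^{1/2}`, with values in `[0, ∞]`. -/
def quadRisk {n : ℕ} (est : (Fin n → ℝ) → ℝ) (ν : Measure ℝ) (t₀ : ℝ)
    (cl : Set (Measure ℝ)) : ℝ≥0∞ :=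
  ⨆ μ ∈ cl, (∫⁻ y, ENNReal.ofReal (|est y - cdf μ t₀| ^ 2) ∂(obsLaw μ ν n)) ^ (1 / 2 : ℝ)

/-- The thresholds `δ ∈ [0, ∞]` with `sup_F P[|F̃ - F(t₀)| > δ] ≤ ε`. -/
def epsThresholds {n : ℕ} (ε : ℝ) (est : (Fin n → ℝ) → ℝ) (ν : Measure ℝ) (t₀ : ℝ)
    (cl : Set (Measure ℝ)) : Set ℝ≥0∞ :=
  {δ | ⨆ μ ∈ cl, obsLaw μ ν n {y | δ < ENNReal.ofReal |est y - cdf μ t₀|} ≤ ENNReal.ofReal ε}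

/-- The `ε`-risk: the least `δ` with `sup_F P[|F̃ - F(t₀)| > δ] ≤ ε`, with values in `[0, ∞]`. -/
def epsRisk {n : ℕ} (ε : ℝ) (est : (Fin n → ℝ) → ℝ) (ν : Measure ℝ) (t₀ : ℝ)
    (cl : Set (Measure ℝ)) : ℝ≥0∞ :=
  sInf (epsThresholds ε est ν t₀ cl)

/-- The infimum defining the `ε`-risk is a minimum. -/
theorem isLeast_epsRisk {n : ℕ} (ε : ℝ) (est : (Fin n → ℝ) → ℝ) (ν : Measure ℝ) (t₀ : ℝ)
    (cl : Set (Measure ℝ)) :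
    IsLeast (epsThresholds ε est ν t₀ cl) (epsRisk ε est ν t₀ cl) := by
  have htop : (⊤ : ℝ≥0∞) ∈ epsThresholds ε est ν t₀ cl := by simp [epsThresholds]
  refine ⟨?_, fun _ h => sInf_le h⟩
  obtain ⟨u, hanti, hlim, hu⟩ :=
    exists_seq_tendsto_sInf (S := epsThresholds ε est ν t₀ cl) ⟨⊤, htop⟩ (OrderBot.bddBelow _)
  change (⨆ μ ∈ cl, obsLaw μ ν n {y : Fin n → ℝ | epsRisk ε est ν t₀ cl <
    ENNReal.ofReal |est y - cdf μ t₀|}) ≤ ENNReal.ofReal ε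
  refine iSup₂_le fun μ hμ => ?_
  have hset : {y : Fin n → ℝ | epsRisk ε est ν t₀ cl < ENNReal.ofReal |est y - cdf μ t₀|} =
      ⋃ k, {y : Fin n → ℝ | u k < ENNReal.ofReal |est y - cdf μ t₀|} := by
    ext y
    simp only [Set.mem_ofPred_eq, Set.mem_iUnion]
    constructor
    · intro h
      exact (hlim.eventually (gt_mem_nhds h)).exists
    · rintro ⟨k, hk⟩
      exact lt_of_le_of_lt (sInf_le (hu k)) hk
  have hmono : Monotone fun k => {y : Fin n → ℝ | u k < ENNReal.ofReal |est y - cdf μ t₀|} :=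
    fun i j hij y hy => lt_of_le_of_lt (hanti hij) hy
  rw [hset, hmono.measure_iUnion]
  exact iSup_le fun k => (le_iSup₂ (f := fun μ (_ : μ ∈ cl) =>
    obsLaw μ ν n {y | u k < ENNReal.ofReal |est y - cdf μ t₀|}) μ hμ).trans (hu k)

/-- The integrand `ω⁻¹ Im {e^{iω(y - t₀)} / f̂_ζ(ω)}`. -/
def invIntegrand (fζ : ℝ → ℝ) (t₀ y ω : ℝ) : ℝ :=
  1 / ω * (Complex.exp (Complex.I * (ω : ℂ) * ((y - t₀ : ℝ) : ℂ)) / fourierTr fζ ω).im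

/-- The Fourier-inversion estimator of `F(t₀)`,
`F̃_lam = 1/2 - n⁻¹ ∑_j π⁻¹ ∫₀^lam ω⁻¹ Im {e^{iω(Y_j - t₀)} / f̂_ζ(ω)} dω`. -/
def invEstimator (fζ : ℝ → ℝ) (t₀ lam : ℝ) {n : ℕ} (Y : Fin n → ℝ) : ℝ :=
  1 / 2 - 1 / (n : ℝ) *
    ∑ j, 1 / Real.pi * ∫ ω in (0 : ℝ)..lam, invIntegrand fζ t₀ (Y j) ω

/-- Ordinary smooth errors:
`c (1 + ω²)^{-β/2} ≤ |f̂_ζ(ω)| ≤ C (1 + ω²)^{-β/2}` for all real `ω`. -/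
def OrdinarySmooth (fζ : ℝ → ℝ) (β c C : ℝ) : Prop :=
  ∀ ω : ℝ, c * (1 + ω ^ 2) ^ (-β / 2) ≤ ‖fourierTr fζ ω‖ ∧
    ‖fourierTr fζ ω‖ ≤ C * (1 + ω ^ 2) ^ (-β / 2)

/-- Behaviour near the origin: `|f̂_ζ(ω)| ≥ 1 - b |ω|^τ` whenever `|ω| ≤ ω₀`. -/
def NearOrigin (fζ : ℝ → ℝ) (ω₀ b τ : ℝ) : Prop :=
  ∀ ω : ℝ, |ω| ≤ ω₀ → 1 - b * |ω| ^ τ ≤ ‖fourierTr fζ ω‖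

/-- `λ(z) = z^{1/[2α + (2β ∨ 1)]}`, used for `z ≥ 1`. -/
def bandwidth (α β z : ℝ) : ℝ := z ^ (1 / (2 * α + max (2 * β) 1))

open Classical in
/-- The rate `ψ(z)`, used for `z ≥ 1`. -/
def rate (α β z : ℝ) : ℝ :=
  if 1 / 2 < β then z ^ (-(2 * α + 1) / (4 * α + 4 * β))
  else if β = 1 / 2 then Real.sqrt (Real.log z / z)
  else 1 / Real.sqrt z

theorem measurable_fourierTr {g : ℝ → ℝ} (hg : Measurable g) : Measurable (fourierTr g) := by
  refine (StronglyMeasurable.integral_prod_right (E := ℂ)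
    (f := fun ω x : ℝ => (g x : ℂ) * Complex.exp (Complex.I * (ω : ℂ) * (x : ℂ)))
    ?_).measurable
  apply Measurable.stronglyMeasurable
  fun_prop

/-- The estimator is a measurable function of the observations. -/
theorem measurable_invEstimator {fζ : ℝ → ℝ} (hf : Measurable fζ) (t₀ lam : ℝ) (n : ℕ) :
    Measurable (invEstimator fζ t₀ lam (n := n)) := by
  have hft := measurable_fourierTr hf
  have hm : Measurable (Function.uncurry fun y ω : ℝ => invIntegrand fζ t₀ y ω) := by
    unfold invIntegrand Function.uncurry
    fun_prop
  have hI : Measurable fun y : ℝ => ∫ ω in (0 : ℝ)..lam, invIntegrand fζ t₀ y ω := by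
    simp only [intervalIntegral]
    exact (StronglyMeasurable.integral_prod_right hm.stronglyMeasurable).measurable.sub
      (StronglyMeasurable.integral_prod_right hm.stronglyMeasurable).measurable
  have hJ : ∀ j : Fin n, Measurable fun Y : Fin n → ℝ =>
      ∫ ω in (0 : ℝ)..lam, invIntegrand fζ t₀ (Y j) ω :=
    fun j => hI.comp (measurable_pi_apply j)
  unfold invEstimator
  exact measurable_const.sub (measurable_const.mul
    (Finset.measurable_sum _ fun j _ => measurable_const.mul (hJ j)))

end Deconvolution

end

/-!
The estimator is an affine function of the empirical mean of the deconvolution kernel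
`K_λ(x) = ∫₀^λ ω⁻¹ Im {e^{iωx} / φ(ω)} dω` at the points `Y_j - t₀`, where `φ` is the characteristic
function of the error law. Everything therefore reduces to the mean, the second moment and the sup
norm of `K_λ(Y - t₀)`.

*Low frequencies.* The singularity at `ω = 0` is the delicate point, since neither `X` nor `ζ` is
assumed to have any moment. Writing `1 / φ = conj φ / |φ|²` gives
`Im {e^{iωx} / φ(ω)} = |φ(ω)|⁻² E sin (ω (x - ζ))`. Symmetrization turns the bound on `1 - |φ|` into
`E |sin (ω (ζ - ζ'))| = O(ω^(τ/2))`, so that `ω⁻¹ sin (ω (x - ζ))` is absolutely integrable jointly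
in `ω` and `ζ` (`SmoothError.integrable_inv_mul_sin`). By Fubini's theorem the low-frequency part of
the kernel is an average of values of the bounded sine integral, up to a bounded remainder
(`SmoothError.abs_deconvKernel_low_le`).

*Mean and bias.* Averaging over `ζ` cancels `φ`, so `E K_λ(Y - t₀) = E Si (λ (X - t₀))`
(`SmoothError.integral_deconvKernel_conv`). As `λ → ∞` the right side tends to `π/2 - π F(t₀)`, by
the Dirichlet integral, and the remainder is an integral of `|f̂(ω)| / ω` over `ω > λ`, which is
`O(λ^(-(α + 1/2)))` on the Sobolev class (`abs_bias_le`).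

*Stochastic error.* Because `α + β > 1/2`, the characteristic function of `Y` is integrable uniformly
over the class, and Schur's test (`integral_norm_sq_trigIntegral_le`) bounds the second moment of the
high-frequency part by a multiple of `∫ ω^(2β - 2) dω`; its sup norm is `O(λ^β)`. The variance of
the empirical mean gives the quadratic risk and Bernstein's inequality
(`measure_abs_mean_sub_gt_le`) gives the `ε`-risk; at the bandwidth `λ(z)` all terms are `O(ψ(z))`.
-/

namespace Deconvolution

open Set Filter Topology

/-! ### The sine integral -/

/-- The sine integral `Si x = ∫₀ˣ sin u / u du`. -/
noncomputable def sineIntegral (x : ℝ) : ℝ := ∫ u in (0 : ℝ)..x, Real.sinc u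

theorem continuous_sineIntegral : Continuous sineIntegral :=
  intervalIntegral.continuous_primitive
    (fun _ _ => Real.continuous_sinc.intervalIntegrable _ _) 0

theorem sineIntegral_zero : sineIntegral 0 = 0 := by simp [sineIntegral]

theorem sineIntegral_neg (x : ℝ) : sineIntegral (-x) = -sineIntegral x := by
  have h := intervalIntegral.integral_comp_neg (a := 0) (b := x) (fun u => Real.sinc u)
  simp only [Real.sinc_neg, neg_zero] at h
  rw [sineIntegral, sineIntegral, h, intervalIntegral.integral_symm]

theorem integral_exp_neg_mul_Ioi {u : ℝ} (hu : 0 < u) :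
    IntegrableOn (fun t : ℝ => Real.exp (-(u * t))) (Ioi 0) ∧
      ∫ t in Ioi (0 : ℝ), Real.exp (-(u * t)) = u⁻¹ := by
  have h1 := integrableOn_exp_mul_Ioi (a := -u) (by linarith) 0
  have h2 := integral_exp_mul_Ioi (a := -u) (by linarith) 0
  simp only [neg_mul] at h1 h2
  refine ⟨h1, h2.trans ?_⟩
  simp

theorem integral_sin_mul_exp_neg (A t : ℝ) :
    ∫ u in (0 : ℝ)..A, Real.sin u * Real.exp (-(u * t)) =
      (1 + t ^ 2)⁻¹ -
        Real.exp (-(A * t)) * (Real.cos A + t * Real.sin A) * (1 + t ^ 2)⁻¹ := by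
  have hd : ∀ u ∈ uIcc 0 A, HasDerivAt
      (fun u => -(Real.exp (-(u * t)) * (Real.cos u + t * Real.sin u) * (1 + t ^ 2)⁻¹))
      (Real.sin u * Real.exp (-(u * t))) u := by
    intro u _
    have h1 : HasDerivAt (fun u : ℝ => Real.exp (-(u * t))) (Real.exp (-(u * t)) * (-(1 * t))) u :=
      (((hasDerivAt_id u).mul_const t).neg).exp
    have h2 := (Real.hasDerivAt_cos u).add ((Real.hasDerivAt_sin u).const_mul t)
    have h3 := ((h1.mul h2).mul_const ((1 + t ^ 2)⁻¹)).neg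
    refine h3.congr_deriv ?_
    have : (1 + t ^ 2) ≠ 0 := by positivity
    simp only [Pi.add_apply]
    field_simp
    ring
  rw [intervalIntegral.integral_eq_sub_of_hasDerivAt hd
    (Continuous.intervalIntegrable (by fun_prop) _ _)]
  simp
  ring

theorem integrable_sin_mul_exp_neg (A : ℝ) :
    Integrable (Function.uncurry fun u t : ℝ => Real.sin u * Real.exp (-(u * t)))
      ((volume.restrict (Ioc 0 A)).prod (volume.restrict (Ioi 0))) := by
  have hmeas : AEStronglyMeasurable
      (Function.uncurry fun u t : ℝ => Real.sin u * Real.exp (-(u * t)))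
      ((volume.restrict (Ioc 0 A)).prod (volume.restrict (Ioi 0))) := by
    apply Continuous.aestronglyMeasurable
    unfold Function.uncurry
    fun_prop
  rw [integrable_prod_iff hmeas]
  constructor
  · filter_upwards [ae_restrict_mem measurableSet_Ioc] with u hu
    simp only [Function.uncurry]
    exact (integral_exp_neg_mul_Ioi hu.1).1.const_mul _
  · refine Integrable.congr (f := fun u => |Real.sinc u|) ?_ ?_
    · exact ((Real.continuous_sinc.abs.intervalIntegrable 0 A).1)
    · filter_upwards [ae_restrict_mem measurableSet_Ioc] with u hu
      simp only [Function.uncurry, norm_mul, Real.norm_eq_abs, Real.abs_exp]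
      rw [integral_const_mul, (integral_exp_neg_mul_Ioi hu.1).2, Real.sinc_of_ne_zero hu.1.ne',
        abs_div, abs_of_pos hu.1, div_eq_mul_inv]

/-- Writing `1 / u` as a Laplace integral and exchanging the two integrations evaluates the sine
integral up to a remainder of order `1 / A`; this contains the Dirichlet integral. -/
theorem abs_sineIntegral_sub_le {A : ℝ} (hA : 0 < A) :
    |sineIntegral A - Real.pi / 2| ≤ 2 / A := by
  have h1 : sineIntegral A = ∫ t in Ioi (0 : ℝ), ((1 + t ^ 2)⁻¹ -
      Real.exp (-(A * t)) * (Real.cos A + t * Real.sin A) * (1 + t ^ 2)⁻¹) := by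
    have h2 := integral_integral_swap (integrable_sin_mul_exp_neg A)
    rw [sineIntegral, intervalIntegral.integral_of_le hA.le]
    refine Eq.trans (setIntegral_congr_fun measurableSet_Ioc fun u hu => ?_) (h2.trans ?_)
    · rw [integral_const_mul, (integral_exp_neg_mul_Ioi hu.1).2, Real.sinc_of_ne_zero hu.1.ne',
        div_eq_mul_inv]
    · refine integral_congr_ae (Eventually.of_forall fun t => ?_)
      simp only
      rw [← integral_sin_mul_exp_neg, intervalIntegral.integral_of_le hA.le]
  have hb : ∀ t ∈ Ioi (0 : ℝ),
      ‖Real.exp (-(A * t)) * (Real.cos A + t * Real.sin A) * (1 + t ^ 2)⁻¹‖ ≤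
        2 * Real.exp (-(A * t)) := by
    intro t ht
    have ht' : 0 < t := ht
    have hq : (0 : ℝ) < 1 + t ^ 2 := by positivity
    have h3 : |Real.cos A + t * Real.sin A| ≤ 2 * (1 + t ^ 2) := by
      have := abs_add_le (Real.cos A) (t * Real.sin A)
      rw [abs_mul, abs_of_pos ht'] at this
      nlinarith [Real.abs_cos_le_one A, Real.abs_sin_le_one A, sq_nonneg (t - 1)]
    rw [norm_mul, norm_mul, Real.norm_eq_abs, Real.norm_eq_abs, Real.norm_eq_abs, Real.abs_exp,
      abs_of_pos (inv_pos.2 hq), mul_assoc, ← div_eq_mul_inv]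
    rw [mul_comm]
    gcongr
    rwa [div_le_iff₀ hq]
  have hE := integral_exp_neg_mul_Ioi hA
  have hint : IntegrableOn (fun t : ℝ =>
      Real.exp (-(A * t)) * (Real.cos A + t * Real.sin A) * (1 + t ^ 2)⁻¹) (Ioi 0) := by
    refine Integrable.mono' (hE.1.const_mul 2) ?_ ?_
    · refine Measurable.aestronglyMeasurable ?_
      fun_prop
    · filter_upwards [ae_restrict_mem measurableSet_Ioi] with t ht using hb t ht
  rw [h1, integral_sub integrable_inv_one_add_sq.integrableOn hint, integral_Ioi_inv_one_add_sq,
    Real.arctan_zero, sub_zero, sub_sub_cancel_left, abs_neg]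
  calc _ ≤ ∫ t in Ioi (0 : ℝ), 2 * Real.exp (-(A * t)) :=
        norm_integral_le_of_norm_le (hE.1.const_mul 2)
          ((ae_restrict_iff' measurableSet_Ioi).2 (Eventually.of_forall hb))
    _ = 2 / A := by rw [integral_const_mul, hE.2, div_eq_mul_inv]

theorem tendsto_sineIntegral_atTop : Tendsto sineIntegral atTop (𝓝 (Real.pi / 2)) := by
  rw [tendsto_iff_norm_sub_tendsto_zero]
  refine squeeze_zero' (Eventually.of_forall fun _ => norm_nonneg _) ?_
    (tendsto_const_nhds (x := (2 : ℝ)).div_atTop tendsto_id)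
  filter_upwards [eventually_gt_atTop 0] with A hA using abs_sineIntegral_sub_le hA

theorem abs_sineIntegral_le (x : ℝ) : |sineIntegral x| ≤ 4 := by
  have hpos : ∀ x : ℝ, 0 ≤ x → |sineIntegral x| ≤ 4 := by
    intro x hx
    rcases le_total x 1 with h | h
    · have := intervalIntegral.norm_integral_le_of_norm_le_const (a := 0) (b := x)
        (f := Real.sinc) (C := 1) fun u _ => Real.abs_sinc_le_one u
      rw [sub_zero, abs_of_nonneg hx, Real.norm_eq_abs] at this
      rw [sineIntegral]
      linarith
    · have h1 := abs_sineIntegral_sub_le (zero_lt_one.trans_le h)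
      have h2 : 2 / x ≤ 2 := div_le_self (by norm_num) h
      have h3 := abs_le.1 (h1.trans h2)
      have := Real.pi_le_four
      have := Real.pi_pos
      rw [abs_le]
      constructor <;> linarith
  rcases le_total 0 x with h | h
  · exact hpos x h
  · rw [← neg_neg x, sineIntegral_neg, abs_neg]
    exact hpos _ (by linarith)

/-- Scaling: `∫ₐᵇ ω⁻¹ sin (ω x) dω = Si (b x) - Si (a x)`. -/
theorem integral_inv_mul_sin (a b x : ℝ) :
    ∫ ω in a..b, ω⁻¹ * Real.sin (ω * x) = sineIntegral (b * x) - sineIntegral (a * x) := by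
  rcases eq_or_ne x 0 with rfl | hx
  · simp
  have h0 : ∀ᵐ ω : ℝ, ω ≠ 0 := by simp [ae_iff, measure_singleton]
  have h1 : ∫ ω in a..b, ω⁻¹ * Real.sin (ω * x) = ∫ ω in a..b, x * Real.sinc (ω * x) := by
    refine intervalIntegral.integral_congr_ae ?_
    filter_upwards [h0] with ω hω _
    rw [Real.sinc_of_ne_zero (mul_ne_zero hω hx)]
    field_simp
  rw [h1, intervalIntegral.integral_const_mul, intervalIntegral.integral_comp_mul_right _ hx,
    smul_eq_mul, mul_inv_cancel_left₀ hx, sineIntegral, sineIntegral,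
    intervalIntegral.integral_interval_sub_left] <;>
  exact Real.continuous_sinc.intervalIntegrable _ _

/-! ### The error law near the origin -/

/-- The properties of the error law `ν` on which the analysis rests: polynomial decay of its
characteristic function from both sides, and its behaviour near the origin. -/
structure SmoothError (ν : Measure ℝ) (β c C ω₀ b τ : ℝ) : Prop where
  lower : ∀ ω : ℝ, c * (1 + ω ^ 2) ^ (-β / 2) ≤ ‖charFun ν ω‖
  upper : ∀ ω : ℝ, ‖charFun ν ω‖ ≤ C * (1 + ω ^ 2) ^ (-β / 2)
  near : ∀ ω : ℝ, |ω| ≤ ω₀ → 1 - b * |ω| ^ τ ≤ ‖charFun ν ω‖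

theorem IsProbDensity.isProbabilityMeasure {g : ℝ → ℝ} (hg : IsProbDensity g) :
    IsProbabilityMeasure (densityLaw g) :=
  ⟨by rw [densityLaw, withDensity_apply _ MeasurableSet.univ, Measure.restrict_univ,
    hg.lintegral_eq_one]⟩

theorem IsProbDensity.fourierTr_eq_charFun {g : ℝ → ℝ} (hg : IsProbDensity g) (ω : ℝ) :
    fourierTr g ω = charFun (densityLaw g) ω := by
  rw [charFun_apply_real, densityLaw, integral_withDensity_eq_integral_toReal_smul
    hg.measurable.ennreal_ofReal (Eventually.of_forall fun _ => ENNReal.ofReal_lt_top), fourierTr]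
  refine integral_congr_ae (Eventually.of_forall fun x => ?_)
  simp only [ENNReal.toReal_ofReal (hg.nonneg x), Complex.real_smul]
  congr 2
  ring

theorem integrable_of_abs_le_one {α : Type*} {mα : MeasurableSpace α} {P : Measure α}
    [IsFiniteMeasure P] {f : α → ℝ} (hf : Measurable f) (h : ∀ a, |f a| ≤ 1) : Integrable f P :=
  Integrable.of_bound hf.aestronglyMeasurable 1 (Eventually.of_forall h)

theorem integrable_cexp_mul_I {P : Measure ℝ} [IsFiniteMeasure P] {f : ℝ → ℝ}
    (hf : Measurable f) : Integrable (fun ζ => Complex.exp (f ζ * Complex.I)) P := by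
  refine Integrable.of_bound (Measurable.aestronglyMeasurable (by fun_prop)) 1
    (Eventually.of_forall fun ζ => ?_)
  rw [Complex.norm_exp_ofReal_mul_I]

theorem cexp_mul_conj_charFun (ν : Measure ℝ) (ω x : ℝ) :
    Complex.exp ((ω * x : ℝ) * Complex.I) * (starRingEnd ℂ) (charFun ν ω) =
      ∫ ζ, Complex.exp ((ω * (x - ζ) : ℝ) * Complex.I) ∂ν := by
  rw [← charFun_neg, charFun_apply_real, ← integral_const_mul]
  refine integral_congr_ae (Eventually.of_forall fun ζ => ?_)
  simp only
  rw [← Complex.exp_add]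
  congr 1
  push_cast
  ring

section

variable {ν : Measure ℝ} {β c C ω₀ b τ : ℝ}

theorem SmoothError.charFun_ne_zero (H : SmoothError ν β c C ω₀ b τ) (hc : 0 < c) (ω : ℝ) : charFun ν ω ≠ 0 := by
  have h := H.lower ω
  have : 0 < c * (1 + ω ^ 2) ^ (-β / 2) := by positivity
  exact norm_pos_iff.1 (this.trans_le h)

theorem SmoothError.inv_norm_charFun_le (H : SmoothError ν β c C ω₀ b τ) (hc : 0 < c) (ω : ℝ) :
    ‖charFun ν ω‖⁻¹ ≤ c⁻¹ * (1 + ω ^ 2) ^ (β / 2) := by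
  have h := H.lower ω
  have h0 : 0 < c * (1 + ω ^ 2) ^ (-β / 2) := by positivity
  refine (inv_anti₀ h0 h).trans_eq ?_
  rw [mul_inv, ← Real.rpow_neg (by positivity)]
  congr 2
  ring

variable [IsProbabilityMeasure ν]

theorem im_cexp_mul_conj_charFun (ω x : ℝ) :
    (Complex.exp ((ω * x : ℝ) * Complex.I) * (starRingEnd ℂ) (charFun ν ω)).im =
      ∫ ζ, Real.sin (ω * (x - ζ)) ∂ν := by
  rw [cexp_mul_conj_charFun]
  have h := integral_im (𝕜 := ℂ)
    (integrable_cexp_mul_I (P := ν) (f := fun ζ => ω * (x - ζ)) (by fun_prop))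
  refine h.symm.trans (integral_congr_ae (Eventually.of_forall fun ζ => ?_))
  exact Complex.exp_ofReal_mul_I_im _

theorem re_cexp_mul_conj_charFun (ω x : ℝ) :
    (Complex.exp ((ω * x : ℝ) * Complex.I) * (starRingEnd ℂ) (charFun ν ω)).re =
      ∫ ζ, Real.cos (ω * (x - ζ)) ∂ν := by
  rw [cexp_mul_conj_charFun]
  have h := integral_re (𝕜 := ℂ)
    (integrable_cexp_mul_I (P := ν) (f := fun ζ => ω * (x - ζ)) (by fun_prop))
  refine h.symm.trans (integral_congr_ae (Eventually.of_forall fun ζ => ?_))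
  exact Complex.exp_ofReal_mul_I_re _

/-- `E cos (ω (ζ - ζ')) = |φ(ω)|²` for independent `ζ, ζ'` with characteristic function `φ`. -/
theorem integral_cos_sub (ω : ℝ) :
    ∫ p, Real.cos (ω * (p.1 - p.2)) ∂(ν.prod ν) = ‖charFun ν ω‖ ^ 2 := by
  have hi : Integrable (fun p : ℝ × ℝ => Real.cos (ω * (p.1 - p.2))) (ν.prod ν) :=
    integrable_of_abs_le_one (by fun_prop) fun _ => Real.abs_cos_le_one _
  rw [integral_prod _ hi]
  simp only [← re_cexp_mul_conj_charFun]
  have h := integral_re (𝕜 := ℂ) (((integrable_cexp_mul_I (P := ν) (f := fun x => ω * x)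
    (by fun_prop))).mul_const ((starRingEnd ℂ) (charFun ν ω)))
  refine h.trans ?_
  rw [integral_mul_const]
  have h2 : ∫ x, Complex.exp ((ω * x : ℝ) * Complex.I) ∂ν = charFun ν ω := by
    rw [charFun_apply_real]
    push_cast
    rfl
  rw [h2, Complex.mul_conj, Complex.normSq_eq_norm_sq]
  exact Complex.ofReal_re _

theorem abs_integral_sin_le_one (ω x : ℝ) : |∫ ζ, Real.sin (ω * (x - ζ)) ∂ν| ≤ 1 := by
  have := norm_integral_le_of_norm_le_const (μ := ν) (f := fun ζ => Real.sin (ω * (x - ζ))) (C := 1)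
    (Eventually.of_forall fun ζ => Real.abs_sin_le_one _)
  simpa using this

namespace SmoothError

variable (H : SmoothError ν β c C ω₀ b τ)
include H

theorem one_sub_norm_sq_le {ω : ℝ} (hω : 0 ≤ ω) (hω' : ω ≤ ω₀) :
    1 - ‖charFun ν ω‖ ^ 2 ≤ 2 * b * ω ^ τ := by
  have h := H.near ω (by rwa [abs_of_nonneg hω])
  rw [abs_of_nonneg hω] at h
  have h1 := norm_charFun_le_one (μ := ν) ω
  nlinarith [norm_nonneg (charFun ν ω)]

/-- The symmetrized error is small at scale `1 / ω` in the mean: this bound is what makes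
`ω⁻¹ E |sin (ω (ζ - ζ'))|` integrable at the origin, with no moment assumption on `ζ`. -/
theorem integral_abs_sin_sub_le {ω : ℝ} (hω : 0 < ω) (hω' : ω ≤ ω₀) :
    ∫ p, |Real.sin (ω * (p.1 - p.2))| ∂(ν.prod ν) ≤ (1 / 2 + 2 * b) * ω ^ (τ / 2) := by
  set κ := ω ^ (τ / 2) with hκ
  have hκ0 : 0 < κ := by positivity
  have hκ2 : κ * κ = ω ^ τ := by
    rw [hκ, ← Real.rpow_add hω]
    congr 1
    ring
  -- `2 κ |sin θ| ≤ κ² + sin² θ ≤ κ² + 2 (1 - cos θ)`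
  have hpt : ∀ θ : ℝ, |Real.sin θ| ≤ κ / 2 + (1 - Real.cos θ) * κ⁻¹ := by
    intro θ
    rw [← sub_le_iff_le_add', ← div_eq_mul_inv, le_div_iff₀ hκ0]
    have h1 := Real.sin_sq_add_cos_sq θ
    have h2 := Real.cos_le_one θ
    have h3 := Real.neg_one_le_cos θ
    nlinarith [sq_abs (Real.sin θ), sq_nonneg (|Real.sin θ| - κ)]
  have hi : Integrable (fun p : ℝ × ℝ => Real.cos (ω * (p.1 - p.2))) (ν.prod ν) :=
    integrable_of_abs_le_one (by fun_prop) fun _ => Real.abs_cos_le_one _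
  have hi1 : Integrable (fun p : ℝ × ℝ => (1 - Real.cos (ω * (p.1 - p.2))) * κ⁻¹) (ν.prod ν) :=
    ((integrable_const _).sub hi).mul_const _
  calc _ ≤ ∫ p, (κ / 2 + (1 - Real.cos (ω * (p.1 - p.2))) * κ⁻¹) ∂(ν.prod ν) := by
        refine integral_mono ?_ ((integrable_const _).add hi1) fun p => hpt _
        refine integrable_of_abs_le_one (by fun_prop) fun p => ?_
        rw [abs_abs]
        exact Real.abs_sin_le_one _
    _ = κ / 2 + (1 - ‖charFun ν ω‖ ^ 2) * κ⁻¹ := by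
        rw [integral_add (integrable_const _) hi1, integral_mul_const,
          integral_sub (integrable_const _) hi, integral_cos_sub]
        simp
    _ ≤ κ / 2 + (2 * b * ω ^ τ) * κ⁻¹ := by
        gcongr
        exact H.one_sub_norm_sq_le hω.le hω'
    _ = (1 / 2 + 2 * b) * κ := by
        rw [← hκ2]
        field_simp

theorem integrable_inv_mul_sin_sub (hω₀ : 0 < ω₀) (hb : 0 < b) (hτ : 0 < τ) (lam : ℝ) :
    Integrable (fun p : ℝ × ℝ × ℝ => p.1⁻¹ * Real.sin (p.1 * (p.2.1 - p.2.2)))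
      ((volume.restrict (Ioc 0 lam)).prod (ν.prod ν)) := by
  have hmeas : AEStronglyMeasurable
      (fun p : ℝ × ℝ × ℝ => p.1⁻¹ * Real.sin (p.1 * (p.2.1 - p.2.2)))
      ((volume.restrict (Ioc 0 lam)).prod (ν.prod ν)) :=
    Measurable.aestronglyMeasurable (by fun_prop)
  rw [integrable_prod_iff hmeas]
  constructor
  · refine Eventually.of_forall fun ω => ?_
    dsimp only
    refine Integrable.const_mul ?_ _
    exact integrable_of_abs_le_one (by fun_prop) fun _ => Real.abs_sin_le_one _
  · have hdom : IntegrableOn (fun ω : ℝ => (1 / 2 + 2 * b) * ω ^ (τ / 2 - 1) + ω₀⁻¹)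
        (Ioc 0 lam) := by
      refine Integrable.add (Integrable.const_mul ?_ _) (integrable_const _)
      exact (intervalIntegral.intervalIntegrable_rpow' (a := 0) (b := lam) (by linarith)).1
    refine Integrable.mono' hdom hmeas.norm.integral_prod_right' ?_
    filter_upwards [ae_restrict_mem measurableSet_Ioc] with ω hω
    have h0 : 0 < ω := hω.1
    have hnn : 0 ≤ ∫ p, |Real.sin (ω * (p.1 - p.2))| ∂(ν.prod ν) :=
      integral_nonneg fun _ => abs_nonneg _
    simp only [norm_mul, Real.norm_eq_abs, integral_const_mul, abs_of_pos (inv_pos.2 h0)]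
    rw [abs_of_nonneg (by positivity)]
    rcases le_total ω ω₀ with h | h
    · have h1 := H.integral_abs_sin_sub_le h0 h
      calc _ ≤ ω⁻¹ * ((1 / 2 + 2 * b) * ω ^ (τ / 2)) := by gcongr
        _ = (1 / 2 + 2 * b) * ω ^ (τ / 2 - 1) := by
          rw [Real.rpow_sub_one h0.ne']
          ring
        _ ≤ _ := le_add_of_nonneg_right (by positivity)
    · have h1 : ∫ p, |Real.sin (ω * (p.1 - p.2))| ∂(ν.prod ν) ≤ 1 := by
        have := norm_integral_le_of_norm_le_const (μ := ν.prod ν)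
          (f := fun p => |Real.sin (ω * (p.1 - p.2))|) (C := 1)
          (Eventually.of_forall fun p => by
            rw [Real.norm_eq_abs, abs_abs]; exact Real.abs_sin_le_one _)
        rw [Real.norm_eq_abs, abs_of_nonneg hnn] at this
        simpa using this
      calc _ ≤ ω₀⁻¹ * 1 := by gcongr
        _ ≤ _ := by
          rw [mul_one]
          exact le_add_of_nonneg_left (by positivity)

/-- The integrand is absolutely integrable jointly in `ω` and in one error variable, for every
centering `x`: Fubini's theorem yields one good centering `m`, and changing `m` into `x` costs at
most `ω |x - m|` inside the sine. -/
theorem integrable_inv_mul_sin (hω₀ : 0 < ω₀) (hb : 0 < b) (hτ : 0 < τ) (lam x : ℝ) :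
    Integrable (fun p : ℝ × ℝ => p.1⁻¹ * Real.sin (p.1 * (x - p.2)))
      ((volume.restrict (Ioc 0 lam)).prod ν) := by
  have h1 := H.integrable_inv_mul_sin_sub hω₀ hb hτ lam
  have h2 := ((measurePreserving_prodAssoc (volume.restrict (Ioc 0 lam)) ν ν).integrable_comp_emb
    MeasurableEquiv.prodAssoc.measurableEmbedding).2 h1
  obtain ⟨m, hm⟩ := h2.prod_left_ae.exists
  refine Integrable.mono' (hm.norm.add (integrable_const |x - m|))
    (Measurable.aestronglyMeasurable (by fun_prop)) (Eventually.of_forall fun p => ?_)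
  have e1 : |Real.sin (p.1 * (x - p.2))| ≤ |Real.sin (p.1 * (p.2 - m))| + |p.1 * (x - m)| := by
    have e2 : p.1 * (x - p.2) = p.1 * (x - m) - p.1 * (p.2 - m) := by ring
    rw [e2, Real.sin_sub]
    refine (abs_sub _ _).trans ?_
    rw [abs_mul, abs_mul, add_comm]
    have a1 := Real.abs_cos_le_one (p.1 * (p.2 - m))
    have a2 := Real.abs_cos_le_one (p.1 * (x - m))
    have a3 := Real.abs_sin_le_abs (x := p.1 * (x - m))
    have a4 := abs_nonneg (Real.sin (p.1 * (p.2 - m)))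
    have a5 := abs_nonneg (Real.sin (p.1 * (x - m)))
    nlinarith
  have e3 : |p.1⁻¹| * |p.1 * (x - m)| ≤ |x - m| := by
    rw [← abs_mul]
    rcases eq_or_ne p.1 0 with h | h
    · simp [h]
    · rw [inv_mul_cancel_left₀ h]
  have e4 := mul_le_mul_of_nonneg_left e1 (abs_nonneg p.1⁻¹)
  simp only [Function.comp, MeasurableEquiv.prodAssoc, norm_mul, Real.norm_eq_abs, Pi.add_apply]
  simp only [MeasurableEquiv.coe_mk, Equiv.prodAssoc_apply]
  linarith

end SmoothError

end

/-! ### The deconvolution kernel -/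

/-- The integrand of the deconvolution kernel with error law `ν`,
`ω⁻¹ Im {e^{iωx} / φ(ω)}`, where `φ` is the characteristic function of `ν`. -/
noncomputable def deconvIntegrand (ν : Measure ℝ) (x ω : ℝ) : ℝ :=
  ω⁻¹ * (Complex.exp ((ω * x : ℝ) * Complex.I) / charFun ν ω).im

/-- The deconvolution kernel `∫₀^lam ω⁻¹ Im {e^{iωx} / φ(ω)} dω`; up to affine normalization the
estimator is the empirical mean of its values at `Y_j - t₀`. -/
noncomputable def deconvKernel (ν : Measure ℝ) (lam x : ℝ) : ℝ :=
  ∫ ω in (0 : ℝ)..lam, deconvIntegrand ν x ω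

theorem IsProbDensity.invIntegrand_eq {fζ : ℝ → ℝ} (hf : IsProbDensity fζ) (t₀ y : ℝ) :
    invIntegrand fζ t₀ y = deconvIntegrand (densityLaw fζ) (y - t₀) := by
  ext ω
  rw [invIntegrand, deconvIntegrand, hf.fourierTr_eq_charFun, one_div]
  have h : Complex.I * (ω : ℂ) * ((y - t₀ : ℝ) : ℂ) = ((ω * (y - t₀) : ℝ) : ℂ) * Complex.I := by
    push_cast
    ring
  rw [h]

theorem IsProbDensity.invEstimator_eq {fζ : ℝ → ℝ} (hf : IsProbDensity fζ) (t₀ lam : ℝ) {n : ℕ}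
    (Y : Fin n → ℝ) :
    invEstimator fζ t₀ lam Y =
      1 / 2 - 1 / Real.pi * (1 / n * ∑ j, deconvKernel (densityLaw fζ) lam (Y j - t₀)) := by
  simp only [invEstimator, hf.invIntegrand_eq, deconvKernel, Finset.mul_sum]
  congr 1
  refine Finset.sum_congr rfl fun j _ => ?_
  ring

section

variable {ν : Measure ℝ} {β c C ω₀ b τ : ℝ}

theorem norm_cexp_div_le (x ω : ℝ) :
    ‖Complex.exp ((ω * x : ℝ) * Complex.I) / charFun ν ω‖ = ‖charFun ν ω‖⁻¹ := by
  rw [norm_div, Complex.norm_exp_ofReal_mul_I, one_div]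

theorem SmoothError.inv_norm_charFun_le_of_le (H : SmoothError ν β c C ω₀ b τ) (hβ : 0 < β)
    (hc : 0 < c) {ω lam : ℝ} (h0 : 0 ≤ ω) (h1 : ω ≤ lam) : ‖charFun ν ω‖⁻¹ ≤ c⁻¹ * (1 + lam ^ 2) ^ (β / 2) := by
  refine (H.inv_norm_charFun_le hc ω).trans ?_
  gcongr

theorem SmoothError.inv_norm_charFun_sq_le_of_le (H : SmoothError ν β c C ω₀ b τ) (hβ : 0 < β)
    (hc : 0 < c) {ω lam : ℝ} (h0 : 0 ≤ ω) (h1 : ω ≤ lam) : (‖charFun ν ω‖ ^ 2)⁻¹ ≤ (c ^ 2)⁻¹ * (1 + lam ^ 2) ^ β := by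
  have h := H.inv_norm_charFun_le_of_le hβ hc h0 h1
  rw [← inv_pow]
  refine (pow_le_pow_left₀ (by positivity) h 2).trans_eq ?_
  rw [mul_pow, inv_pow, ← Real.rpow_natCast (_ ^ (β / 2)) 2, ← Real.rpow_mul (by positivity)]
  norm_num

theorem SmoothError.norm_inv_mul_inv_charFun_le (H : SmoothError ν β c C ω₀ b τ) (hβ : 0 < β)
    (hc : 0 < c) {w ω : ℝ} (hw : 0 < w) (hω : w ≤ ω) :
    ω⁻¹ * ‖charFun ν ω‖⁻¹ ≤ c⁻¹ * (1 + (w ^ 2)⁻¹) ^ (β / 2) * ω ^ (β - 1) := by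
  have hω0 : 0 < ω := hw.trans_le hω
  have h1 : 1 + ω ^ 2 ≤ (1 + (w ^ 2)⁻¹) * ω ^ 2 := by
    have : 1 ≤ (w ^ 2)⁻¹ * ω ^ 2 := by
      rw [inv_mul_eq_div, one_le_div (by positivity)]
      gcongr
    linarith
  have h2 : (1 + ω ^ 2) ^ (β / 2) ≤ (1 + (w ^ 2)⁻¹) ^ (β / 2) * ω ^ β := by
    refine (Real.rpow_le_rpow (by positivity) h1 (by positivity)).trans_eq ?_
    rw [Real.mul_rpow (by positivity) (by positivity), ← Real.rpow_natCast ω 2,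
      ← Real.rpow_mul hω0.le]
    congr 2
    push_cast
    ring
  calc _ ≤ ω⁻¹ * (c⁻¹ * ((1 + (w ^ 2)⁻¹) ^ (β / 2) * ω ^ β)) := by
        have := H.inv_norm_charFun_le hc ω
        gcongr
        exact this.trans (by gcongr)
    _ = _ := by
        rw [Real.rpow_sub_one hω0.ne']
        ring

variable [IsProbabilityMeasure ν]

theorem measurable_uncurry_deconvIntegrand :
    Measurable (Function.uncurry fun x ω : ℝ => deconvIntegrand ν x ω) := by
  have h := measurable_charFun (μ := ν)
  unfold deconvIntegrand Function.uncurry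
  fun_prop

theorem measurable_deconvKernel (lam : ℝ) : Measurable (deconvKernel ν lam) := by
  have hm := (measurable_uncurry_deconvIntegrand (ν := ν)).stronglyMeasurable
  unfold deconvKernel
  simp only [intervalIntegral]
  exact hm.integral_prod_right.measurable.sub hm.integral_prod_right.measurable

theorem deconvIntegrand_eq (x ω : ℝ) :
    deconvIntegrand ν x ω =
      (‖charFun ν ω‖ ^ 2)⁻¹ * (ω⁻¹ * ∫ ζ, Real.sin (ω * (x - ζ)) ∂ν) := by
  rw [deconvIntegrand, div_eq_mul_inv, Complex.inv_def, ← mul_assoc, Complex.im_mul_ofReal,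
    im_cexp_mul_conj_charFun, Complex.normSq_eq_norm_sq]
  ring

namespace SmoothError

variable (H : SmoothError ν β c C ω₀ b τ)
include H

theorem intervalIntegrable_deconvIntegrand (hβ : 0 < β) (hc : 0 < c) (hω₀ : 0 < ω₀) (hb : 0 < b)
    (hτ : 0 < τ) (x : ℝ) {lam : ℝ} (hlam : 0 ≤ lam) :
    IntervalIntegrable (deconvIntegrand ν x) volume 0 lam := by
  rw [intervalIntegrable_iff_integrableOn_Ioc_of_le hlam]
  have h := (H.integrable_inv_mul_sin hω₀ hb hτ lam x).integral_prod_left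
  simp only [integral_const_mul] at h
  have hm := measurable_charFun (μ := ν)
  have h2 := h.bdd_mul (f := fun ω => (‖charFun ν ω‖ ^ 2)⁻¹)
    (c := (c ^ 2)⁻¹ * (1 + lam ^ 2) ^ β)
    (Measurable.aestronglyMeasurable (by fun_prop)) (by
      filter_upwards [ae_restrict_mem measurableSet_Ioc] with ω hω
      rw [Real.norm_eq_abs, abs_of_nonneg (by positivity)]
      exact H.inv_norm_charFun_sq_le_of_le hβ hc hω.1.le hω.2)
  exact h2.congr (Eventually.of_forall fun ω => (deconvIntegrand_eq x ω).symm)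

/-- The low-frequency part of the kernel is bounded: replacing `|φ|⁻²` by `1` turns it into an
average of values of the sine integral, and the error made is `O(ω^(τ - 1))`. -/
theorem abs_deconvKernel_low_le (hβ : 0 < β) (hc : 0 < c) (hω₀ : 0 < ω₀) (hb : 0 < b)
    (hτ : 0 < τ) (x : ℝ) {w : ℝ} (hw : 0 ≤ w) (hw1 : w ≤ 1) (hw0 : w ≤ ω₀) :
    |deconvKernel ν w x| ≤ 4 + 2 * b * ((c ^ 2)⁻¹ * 2 ^ β) * τ⁻¹ := by
  have hs := H.integrable_inv_mul_sin hω₀ hb hτ w x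
  have hs1 := hs.integral_prod_left
  simp only [integral_const_mul] at hs1
  have h1 : ∫ ω in Ioc 0 w, ω⁻¹ * ∫ ζ, Real.sin (ω * (x - ζ)) ∂ν =
      ∫ ζ, sineIntegral (w * (x - ζ)) ∂ν := by
    have := integral_integral_swap (f := fun ω ζ => ω⁻¹ * Real.sin (ω * (x - ζ))) hs
    simp only [integral_const_mul] at this
    rw [this]
    refine integral_congr_ae (Eventually.of_forall fun ζ => ?_)
    have h2 := integral_inv_mul_sin 0 w (x - ζ)
    rw [intervalIntegral.integral_of_le hw, zero_mul, sineIntegral_zero, sub_zero] at h2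
    exact h2
  have h2 : |∫ ζ, sineIntegral (w * (x - ζ)) ∂ν| ≤ 4 := by
    have := norm_integral_le_of_norm_le_const (μ := ν) (f := fun ζ => sineIntegral (w * (x - ζ)))
      (C := 4) (Eventually.of_forall fun ζ => abs_sineIntegral_le _)
    simpa using this
  have hint := H.intervalIntegrable_deconvIntegrand hβ hc hω₀ hb hτ x hw
  rw [intervalIntegrable_iff_integrableOn_Ioc_of_le hw] at hint
  set K := 2 * b * ((c ^ 2)⁻¹ * 2 ^ β) with hK
  have hdom : IntervalIntegrable (fun ω : ℝ => K * ω ^ (τ - 1)) volume 0 w :=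
    (intervalIntegral.intervalIntegrable_rpow' (by linarith)).const_mul K
  rw [intervalIntegrable_iff_integrableOn_Ioc_of_le hw] at hdom
  have h3 : |∫ ω in Ioc 0 w, (deconvIntegrand ν x ω -
      ω⁻¹ * ∫ ζ, Real.sin (ω * (x - ζ)) ∂ν)| ≤ ∫ ω in Ioc 0 w, K * ω ^ (τ - 1) := by
    refine norm_integral_le_of_norm_le (μ := volume.restrict (Ioc 0 w)) (G := ℝ) hdom ?_
    filter_upwards [ae_restrict_mem measurableSet_Ioc] with ω hω
    have hω0 : 0 < ω := hω.1
    have e1 := H.inv_norm_charFun_sq_le_of_le hβ hc hω.1.le (hω.2.trans hw1)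
    norm_num at e1
    have e2 := H.one_sub_norm_sq_le hω.1.le (hω.2.trans hw0)
    have e3 : 0 < ‖charFun ν ω‖ ^ 2 := by
      have := norm_pos_iff.2 (H.charFun_ne_zero hc ω)
      positivity
    have e4 : ‖charFun ν ω‖ ^ 2 ≤ 1 := pow_le_one₀ (norm_nonneg _) (norm_charFun_le_one _)
    have e5 : deconvIntegrand ν x ω - ω⁻¹ * ∫ ζ, Real.sin (ω * (x - ζ)) ∂ν =
        (1 - ‖charFun ν ω‖ ^ 2) * (‖charFun ν ω‖ ^ 2)⁻¹ *
          ω⁻¹ * ∫ ζ, Real.sin (ω * (x - ζ)) ∂ν := by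
      rw [deconvIntegrand_eq, sub_mul, mul_inv_cancel₀ e3.ne']
      ring
    have e6 : 0 ≤ 1 - ‖charFun ν ω‖ ^ 2 := by linarith
    rw [e5, norm_mul, Real.norm_eq_abs, Real.norm_eq_abs, abs_of_nonneg (by positivity)]
    calc _ ≤ (2 * b * ω ^ τ) * ((c ^ 2)⁻¹ * 2 ^ β) * ω⁻¹ * 1 := by
          gcongr
          exact abs_integral_sin_le_one ω x
      _ = K * ω ^ (τ - 1) := by
          rw [Real.rpow_sub_one hω0.ne']
          ring
  have h4 : ∫ ω in Ioc 0 w, K * ω ^ (τ - 1) ≤ K * τ⁻¹ := by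
    rw [integral_const_mul, ← intervalIntegral.integral_of_le hw,
      integral_rpow (Or.inl (by linarith))]
    have e1 : w ^ τ ≤ 1 := Real.rpow_le_one hw hw1 hτ.le
    rw [sub_add_cancel, Real.zero_rpow hτ.ne', sub_zero, div_eq_mul_inv]
    have : 0 ≤ K := by positivity
    gcongr
    exact mul_le_of_le_one_left (by positivity) e1
  rw [integral_sub hint hs1, h1] at h3
  rw [deconvKernel, intervalIntegral.integral_of_le hw]
  have h5 := abs_sub_abs_le_abs_sub (∫ ω in Ioc 0 w, deconvIntegrand ν x ω)
    (∫ ζ, sineIntegral (w * (x - ζ)) ∂ν)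
  linarith

theorem deconvKernel_sub (hβ : 0 < β) (hc : 0 < c) (hω₀ : 0 < ω₀) (hb : 0 < b) (hτ : 0 < τ)
    (x : ℝ) {w lam : ℝ} (hw : 0 ≤ w) (hlam : 0 ≤ lam) :
    deconvKernel ν lam x - deconvKernel ν w x = ∫ ω in w..lam, deconvIntegrand ν x ω :=
  intervalIntegral.integral_interval_sub_left
    (H.intervalIntegrable_deconvIntegrand hβ hc hω₀ hb hτ x hlam)
    (H.intervalIntegrable_deconvIntegrand hβ hc hω₀ hb hτ x hw)

theorem abs_deconvKernel_sub_le (hβ : 0 < β) (hc : 0 < c) (hω₀ : 0 < ω₀) (hb : 0 < b)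
    (hτ : 0 < τ) (x : ℝ) {w lam : ℝ} (hw : 0 < w) (hlam : w ≤ lam) :
    |deconvKernel ν lam x - deconvKernel ν w x| ≤
      c⁻¹ * (1 + (w ^ 2)⁻¹) ^ (β / 2) * (lam ^ β * β⁻¹) := by
  rw [H.deconvKernel_sub hβ hc hω₀ hb hτ x hw.le (hw.le.trans hlam)]
  set A := c⁻¹ * (1 + (w ^ 2)⁻¹) ^ (β / 2) with hA
  have hint : IntervalIntegrable (fun ω : ℝ => A * ω ^ (β - 1)) volume w lam :=
    (intervalIntegral.intervalIntegrable_rpow' (by linarith)).const_mul A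
  have h := intervalIntegral.norm_integral_le_of_norm_le hlam (f := deconvIntegrand ν x)
    (g := fun ω : ℝ => A * ω ^ (β - 1)) (Eventually.of_forall fun ω hω => by
      have hω0 : 0 < ω := hw.trans hω.1
      rw [deconvIntegrand, norm_mul, Real.norm_eq_abs, abs_of_pos (inv_pos.2 hω0)]
      refine le_trans ?_ (H.norm_inv_mul_inv_charFun_le hβ hc hw hω.1.le)
      rw [← norm_cexp_div_le (ν := ν) x ω]
      gcongr
      exact Complex.abs_im_le_norm _) hint
  rw [Real.norm_eq_abs] at h
  refine h.trans ?_
  rw [intervalIntegral.integral_const_mul, integral_rpow (Or.inl (by linarith)), sub_add_cancel,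
    div_eq_mul_inv]
  have h1 : 0 ≤ w ^ β := by positivity
  have : 0 ≤ A := by positivity
  gcongr
  linarith

/-- Joint integrability of the kernel integrand in `ω` and in the error variable, after a shift
by `x`. -/
theorem integrable_deconvIntegrand_add (hβ : 0 < β) (hc : 0 < c) (hω₀ : 0 < ω₀) (hb : 0 < b)
    (hτ : 0 < τ) (lam x : ℝ) :
    Integrable (Function.uncurry fun ω ζ => deconvIntegrand ν (x + ζ) ω)
      ((volume.restrict (Ioc 0 lam)).prod ν) := by
  have h1 := H.integrable_inv_mul_sin_sub hω₀ hb hτ lam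
  have h2 : Integrable (fun p : ℝ × ℝ × ℝ => p.1⁻¹ * Real.sin (p.1 * (x + p.2.1 - p.2.2)))
      ((volume.restrict (Ioc 0 lam)).prod (ν.prod ν)) := by
    refine Integrable.mono' (h1.norm.add (integrable_const |x|))
      (Measurable.aestronglyMeasurable (by fun_prop)) (Eventually.of_forall fun p => ?_)
    have e1 : |Real.sin (p.1 * (x + p.2.1 - p.2.2))| ≤
        |Real.sin (p.1 * (p.2.1 - p.2.2))| + |p.1 * x| := by
      have e2 : p.1 * (x + p.2.1 - p.2.2) = p.1 * x + p.1 * (p.2.1 - p.2.2) := by ring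
      rw [e2, Real.sin_add]
      refine (abs_add_le _ _).trans ?_
      rw [abs_mul, abs_mul, add_comm]
      have a1 := Real.abs_cos_le_one (p.1 * (p.2.1 - p.2.2))
      have a2 := Real.abs_cos_le_one (p.1 * x)
      have a3 := Real.abs_sin_le_abs (x := p.1 * x)
      have a4 := abs_nonneg (Real.sin (p.1 * (p.2.1 - p.2.2)))
      have a5 := abs_nonneg (Real.sin (p.1 * x))
      nlinarith
    have e3 : |p.1⁻¹| * |p.1 * x| ≤ |x| := by
      rw [← abs_mul]
      rcases eq_or_ne p.1 0 with h | h
      · simp [h]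
      · rw [inv_mul_cancel_left₀ h]
    have e4 := mul_le_mul_of_nonneg_left e1 (abs_nonneg p.1⁻¹)
    simp only [norm_mul, Real.norm_eq_abs, Pi.add_apply]
    linarith
  have h3 := ((measurePreserving_prodAssoc (volume.restrict (Ioc 0 lam)) ν ν).integrable_comp_emb
    MeasurableEquiv.prodAssoc.measurableEmbedding).2 h2
  have h4 := h3.integral_prod_left
  simp only [Function.comp, MeasurableEquiv.prodAssoc, MeasurableEquiv.coe_mk,
    Equiv.prodAssoc_apply, integral_const_mul] at h4
  have hm := measurable_charFun (μ := ν)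
  have h5 := h4.bdd_mul (f := fun p : ℝ × ℝ => (‖charFun ν p.1‖ ^ 2)⁻¹)
    (c := (c ^ 2)⁻¹ * (1 + lam ^ 2) ^ β)
    (Measurable.aestronglyMeasurable (by fun_prop)) (by
      have h6 : ∀ᵐ ω ∂(volume.restrict (Ioc 0 lam)), ω ∈ Ioc 0 lam :=
        ae_restrict_mem measurableSet_Ioc
      filter_upwards [Measure.quasiMeasurePreserving_fst.ae h6] with p hp
      rw [Real.norm_eq_abs, abs_of_nonneg (by positivity)]
      exact H.inv_norm_charFun_sq_le_of_le hβ hc hp.1.le hp.2)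
  exact h5.congr (Eventually.of_forall fun p => (deconvIntegrand_eq (x + p.2) p.1).symm)

/-- Averaging over the error undoes the division by its characteristic function. -/
theorem integral_deconvKernel_add (hβ : 0 < β) (hc : 0 < c) (hω₀ : 0 < ω₀) (hb : 0 < b)
    (hτ : 0 < τ) {lam : ℝ} (hlam : 0 ≤ lam) (x : ℝ) :
    ∫ ζ, deconvKernel ν lam (x + ζ) ∂ν = sineIntegral (lam * x) := by
  have h := integral_integral_swap (H.integrable_deconvIntegrand_add hβ hc hω₀ hb hτ lam x)
  simp only [deconvKernel, intervalIntegral.integral_of_le hlam]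
  rw [← h]
  have h2 := integral_inv_mul_sin 0 lam x
  rw [intervalIntegral.integral_of_le hlam, zero_mul, sineIntegral_zero, sub_zero] at h2
  rw [← h2]
  refine integral_congr_ae (Eventually.of_forall fun ω => ?_)
  simp only [deconvIntegrand, integral_const_mul]
  congr 1
  have hi : Integrable (fun ζ => Complex.exp ((ω * (x + ζ) : ℝ) * Complex.I) / charFun ν ω) ν :=
    (integrable_cexp_mul_I (P := ν) (f := fun ζ => ω * (x + ζ)) (by fun_prop)).div_const _
  refine (integral_im (𝕜 := ℂ) hi).trans ?_
  have h3 : ∫ ζ, Complex.exp ((ω * (x + ζ) : ℝ) * Complex.I) / charFun ν ω ∂ν =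
      Complex.exp ((ω * x : ℝ) * Complex.I) := by
    rw [integral_div, div_eq_iff (H.charFun_ne_zero hc ω), charFun_apply_real,
      ← integral_const_mul]
    refine integral_congr_ae (Eventually.of_forall fun ζ => ?_)
    simp only
    rw [← Complex.exp_add]
    congr 1
    push_cast
    ring
  rw [h3]
  exact Complex.exp_ofReal_mul_I_im _

end SmoothError

end

/-! ### The second moment of the kernel -/

/-- Schur's test: the second moment of a trigonometric integral under a law with integrable
characteristic function is controlled by the `L²` norm of the amplitude. -/
theorem integral_norm_sq_trigIntegral_le {P m : Measure ℝ} [IsProbabilityMeasure P]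
    [IsFiniteMeasure m] (hm : m ≤ volume) {g : ℝ → ℂ} (hg : Measurable g) {B : ℝ}
    (hB : ∀ᵐ ω ∂m, ‖g ω‖ ≤ B) {K : ℝ} (hint : Integrable (charFun P))
    (hK : ∫ ω, ‖charFun P ω‖ ≤ K) :
    ∫ y, ‖∫ ω, g ω * Complex.exp ((ω * y : ℝ) * Complex.I) ∂m‖ ^ 2 ∂P ≤
      K * ∫ ω, ‖g ω‖ ^ 2 ∂m := by
  have hmc := measurable_charFun (μ := P)
  have hB1 : ∀ᵐ p ∂(m.prod m), ‖g p.1‖ ≤ B := Measure.quasiMeasurePreserving_fst.ae hB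
  have hB2 : ∀ᵐ p ∂(m.prod m), ‖g p.2‖ ≤ B := Measure.quasiMeasurePreserving_snd.ae hB
  have hgsq : Integrable (fun ω => ‖g ω‖ ^ 2) m := by
    refine Integrable.of_bound (Measurable.aestronglyMeasurable (by fun_prop)) (B ^ 2) ?_
    filter_upwards [hB] with ω hω
    rw [Real.norm_eq_abs, abs_of_nonneg (by positivity)]
    gcongr
  let F : ℝ × ℝ → ℝ → ℂ := fun p y => (g p.1 * Complex.exp ((p.1 * y : ℝ) * Complex.I)) *
    (starRingEnd ℂ) (g p.2 * Complex.exp ((p.2 * y : ℝ) * Complex.I))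
  have hF : ∀ p y, F p y = g p.1 * (starRingEnd ℂ) (g p.2) *
      Complex.exp (((p.1 - p.2) * y : ℝ) * Complex.I) := by
    intro p y
    have e1 : (starRingEnd ℂ) (Complex.exp ((p.2 * y : ℝ) * Complex.I)) =
        Complex.exp (-((p.2 * y : ℝ) * Complex.I)) := by
      rw [← Complex.exp_conj, map_mul, Complex.conj_ofReal, Complex.conj_I, mul_neg]
    simp only [F]
    rw [map_mul, e1, mul_mul_mul_comm, ← Complex.exp_add]
    congr 2
    push_cast
    ring
  have hFnorm : ∀ p y, ‖F p y‖ = ‖g p.1‖ * ‖g p.2‖ := by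
    intro p y
    rw [hF, norm_mul, Complex.norm_exp_ofReal_mul_I, mul_one, norm_mul, RCLike.norm_conj]
  have hFint : Integrable (Function.uncurry F) ((m.prod m).prod P) := by
    refine Integrable.of_bound (C := B * B) (Measurable.aestronglyMeasurable ?_) ?_
    · have : Function.uncurry F = fun q : (ℝ × ℝ) × ℝ => g q.1.1 * (starRingEnd ℂ) (g q.1.2) *
          Complex.exp (((q.1.1 - q.1.2) * q.2 : ℝ) * Complex.I) := by
        ext q
        exact hF q.1 q.2
      rw [this]
      have hc : Measurable (starRingEnd ℂ) := Complex.continuous_conj.measurable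
      fun_prop
    · filter_upwards [Measure.quasiMeasurePreserving_fst.ae hB1,
        Measure.quasiMeasurePreserving_fst.ae hB2] with q h1 h2
      rw [Function.uncurry, hFnorm]
      exact mul_le_mul h1 h2 (norm_nonneg _) ((norm_nonneg _).trans h1)
  have hswap := integral_integral_swap hFint
  have h1 : ∀ y, ∫ p, F p y ∂(m.prod m) =
      ((‖∫ ω, g ω * Complex.exp ((ω * y : ℝ) * Complex.I) ∂m‖ ^ 2 : ℝ) : ℂ) := by
    intro y
    simp only [F]
    rw [integral_prod_mul (fun ω => g ω * Complex.exp ((ω * y : ℝ) * Complex.I))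
      (fun ω => (starRingEnd ℂ) (g ω * Complex.exp ((ω * y : ℝ) * Complex.I))), integral_conj,
      Complex.mul_conj, Complex.normSq_eq_norm_sq]
  have h2 : ∀ p, ∫ y, F p y ∂P = g p.1 * (starRingEnd ℂ) (g p.2) * charFun P (p.1 - p.2) := by
    intro p
    simp only [hF, integral_const_mul, charFun_apply_real]
    push_cast
    rfl
  simp only [h1, h2, integral_complex_ofReal] at hswap
  have h3 : ∫ y, ‖∫ ω, g ω * Complex.exp ((ω * y : ℝ) * Complex.I) ∂m‖ ^ 2 ∂P ≤
      ∫ p, (‖g p.1‖ ^ 2 * ‖charFun P (p.1 - p.2)‖ / 2 +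
        ‖g p.2‖ ^ 2 * ‖charFun P (p.1 - p.2)‖ / 2) ∂(m.prod m) := by
    have hnn : 0 ≤ ∫ y, ‖∫ ω, g ω * Complex.exp ((ω * y : ℝ) * Complex.I) ∂m‖ ^ 2 ∂P :=
      integral_nonneg fun _ => by positivity
    have e1 := congrArg norm hswap
    rw [Complex.norm_real, Real.norm_eq_abs, abs_of_nonneg hnn] at e1
    rw [← e1]
    refine norm_integral_le_of_norm_le ?_ (Eventually.of_forall fun p => ?_)
    · refine Integrable.of_bound (C := B ^ 2) (Measurable.aestronglyMeasurable (by fun_prop)) ?_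
      filter_upwards [hB1, hB2] with p e2 e3
      have e4 := norm_charFun_le_one (μ := P) (p.1 - p.2)
      have e5 : ‖g p.1‖ ^ 2 * ‖charFun P (p.1 - p.2)‖ ≤ B ^ 2 * 1 := by gcongr
      have e6 : ‖g p.2‖ ^ 2 * ‖charFun P (p.1 - p.2)‖ ≤ B ^ 2 * 1 := by gcongr
      rw [Real.norm_eq_abs, abs_of_nonneg (by positivity)]
      linarith
    · rw [norm_mul, norm_mul, RCLike.norm_conj]
      nlinarith [mul_nonneg (sq_nonneg (‖g p.1‖ - ‖g p.2‖)) (norm_nonneg (charFun P (p.1 - p.2)))]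
  have hi1 : Integrable (fun p : ℝ × ℝ => ‖g p.1‖ ^ 2 * ‖charFun P (p.1 - p.2)‖ / 2)
      (m.prod m) := by
    refine Integrable.of_bound (C := B ^ 2 * 1 / 2)
      (Measurable.aestronglyMeasurable (by fun_prop)) ?_
    filter_upwards [hB1] with p e2
    have e4 := norm_charFun_le_one (μ := P) (p.1 - p.2)
    rw [Real.norm_eq_abs, abs_of_nonneg (by positivity)]
    gcongr
  have hi2 : Integrable (fun p : ℝ × ℝ => ‖g p.2‖ ^ 2 * ‖charFun P (p.1 - p.2)‖ / 2)
      (m.prod m) := by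
    refine Integrable.of_bound (C := B ^ 2 * 1 / 2)
      (Measurable.aestronglyMeasurable (by fun_prop)) ?_
    filter_upwards [hB2] with p e2
    have e4 := norm_charFun_le_one (μ := P) (p.1 - p.2)
    rw [Real.norm_eq_abs, abs_of_nonneg (by positivity)]
    gcongr
  have hL : ∀ ω, ∫ η, ‖charFun P (ω - η)‖ ∂m ≤ K := by
    intro ω
    refine le_trans (integral_mono_measure hm (Eventually.of_forall fun _ => norm_nonneg _)
      (hint.norm.comp_sub_left ω)) ?_
    exact (integral_sub_left_eq_self (fun η => ‖charFun P η‖) volume ω).trans_le hK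
  have hR : ∀ η, ∫ ω, ‖charFun P (ω - η)‖ ∂m ≤ K := by
    intro η
    refine le_trans (integral_mono_measure hm (Eventually.of_forall fun _ => norm_nonneg _)
      (hint.norm.comp_sub_right η)) ?_
    exact (integral_sub_right_eq_self (fun ω => ‖charFun P ω‖) η).trans_le hK
  have h4 : ∫ p, ‖g p.1‖ ^ 2 * ‖charFun P (p.1 - p.2)‖ / 2 ∂(m.prod m) ≤
      ∫ ω, K / 2 * ‖g ω‖ ^ 2 ∂m := by
    rw [integral_prod _ hi1]
    refine integral_mono hi1.integral_prod_left (hgsq.const_mul _) fun ω => ?_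
    simp only [integral_div, integral_const_mul]
    nlinarith [hL ω, sq_nonneg ‖g ω‖]
  have h5 : ∫ p, ‖g p.2‖ ^ 2 * ‖charFun P (p.1 - p.2)‖ / 2 ∂(m.prod m) ≤
      ∫ ω, K / 2 * ‖g ω‖ ^ 2 ∂m := by
    rw [integral_prod_symm _ hi2]
    refine integral_mono hi2.integral_prod_right (hgsq.const_mul _) fun η => ?_
    simp only [integral_div, integral_const_mul]
    nlinarith [hR η, sq_nonneg ‖g η‖]
  rw [integral_add hi1 hi2] at h3
  rw [integral_const_mul] at h4 h5
  linarith

theorem integrable_one_add_sq_rpow {r : ℝ} (hr : 1 / 2 < r) :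
    Integrable fun ω : ℝ => (1 + ω ^ 2) ^ (-r) := by
  have h := integrable_rpow_neg_one_add_norm_sq (E := ℝ) (μ := volume) (r := 2 * r)
    (by simp; linarith)
  refine h.congr (Eventually.of_forall fun ω => ?_)
  simp only [Real.norm_eq_abs, sq_abs]
  congr 1
  ring

theorem sobolevClass_spec {α L : ℝ} {μ : Measure ℝ} (hμ : μ ∈ sobolevClass α L) :
    IsProbabilityMeasure μ ∧ μ ≪ volume ∧
      Integrable (fun ω : ℝ => ‖charFun μ ω‖ ^ 2 * (1 + ω ^ 2) ^ α) ∧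
      ∫ ω : ℝ, ‖charFun μ ω‖ ^ 2 * (1 + ω ^ 2) ^ α ≤ 2 * Real.pi * L ^ 2 := by
  obtain ⟨f, hf, rfl, h⟩ := hμ
  have hp := hf.isProbabilityMeasure
  have hm := measurable_charFun (μ := densityLaw f)
  have hpi := Real.pi_pos
  simp only [hf.fourierTr_eq_charFun] at h
  have hmeas : AEStronglyMeasurable
      (fun ω : ℝ => ‖charFun (densityLaw f) ω‖ ^ 2 * (1 + ω ^ 2) ^ α) volume :=
    Measurable.aestronglyMeasurable (by fun_prop)
  have hnn : ∀ ω : ℝ, 0 ≤ ‖charFun (densityLaw f) ω‖ ^ 2 * (1 + ω ^ 2) ^ α :=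
    fun ω => by positivity
  have h2 : ∫⁻ ω : ℝ, ENNReal.ofReal (‖charFun (densityLaw f) ω‖ ^ 2 * (1 + ω ^ 2) ^ α) ≤
      ENNReal.ofReal (2 * Real.pi * L ^ 2) := by
    have := mul_le_mul_right h (ENNReal.ofReal (2 * Real.pi))
    rw [← mul_assoc, ← ENNReal.ofReal_mul (by positivity), ← ENNReal.ofReal_mul (by positivity),
      mul_one_div_cancel (by positivity), ENNReal.ofReal_one, one_mul] at this
    exact this
  refine ⟨hp, withDensity_absolutelyContinuous _ _, ?_, ?_⟩
  · refine ⟨hmeas, ?_⟩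
    rw [hasFiniteIntegral_iff_ofReal (Eventually.of_forall hnn)]
    exact h2.trans_lt ENNReal.ofReal_lt_top
  · rw [integral_eq_lintegral_of_nonneg_ae (Eventually.of_forall hnn) hmeas]
    exact ENNReal.toReal_le_of_le_ofReal (by positivity) h2

section

variable {ν : Measure ℝ} [IsProbabilityMeasure ν] {α β L c C ω₀ b τ : ℝ}

namespace SmoothError

variable (H : SmoothError ν β c C ω₀ b τ)
include H

/-- Since `α + β > 1/2`, the characteristic function of an observation is integrable, uniformly
over the Sobolev class. -/
theorem integrable_charFun_conv (hC : 0 < C) (hreg : 1 / 2 < α + β) {μ : Measure ℝ}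
    (hμ : μ ∈ sobolevClass α L) :
    Integrable (charFun (μ ∗ ν)) ∧ ∫ ω, ‖charFun (μ ∗ ν) ω‖ ≤
      C / 2 * (2 * Real.pi * L ^ 2 + ∫ ω : ℝ, (1 + ω ^ 2) ^ (-(α + β))) := by
  obtain ⟨hp, -, hi, hle⟩ := sobolevClass_spec hμ
  have hi2 := integrable_one_add_sq_rpow hreg
  have hb : ∀ ω, ‖charFun (μ ∗ ν) ω‖ ≤
      C / 2 * (‖charFun μ ω‖ ^ 2 * (1 + ω ^ 2) ^ α + (1 + ω ^ 2) ^ (-(α + β))) := by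
    intro ω
    have hq : 0 < 1 + ω ^ 2 := by positivity
    set u := (1 + ω ^ 2) ^ (α / 2) with hu
    set v := (1 + ω ^ 2) ^ (-(α + β) / 2) with hv
    have e1 : (1 + ω ^ 2) ^ (-β / 2) = u * v := by
      rw [hu, hv, ← Real.rpow_add hq]
      congr 1
      ring
    have e2 : (1 + ω ^ 2) ^ α = u * u := by
      rw [hu, ← Real.rpow_add hq]
      congr 1
      ring
    have e3 : (1 + ω ^ 2) ^ (-(α + β)) = v * v := by
      rw [hv, ← Real.rpow_add hq]
      congr 1
      ring
    rw [charFun_conv, norm_mul, e2, e3]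
    refine (mul_le_mul_of_nonneg_left (H.upper ω) (norm_nonneg _)).trans ?_
    rw [e1]
    nlinarith [mul_nonneg hC.le (sq_nonneg (‖charFun μ ω‖ * u - v))]
  have hdom := (hi.add hi2).const_mul (C / 2)
  have hint : Integrable (charFun (μ ∗ ν)) :=
    hdom.mono' measurable_charFun.aestronglyMeasurable (Eventually.of_forall hb)
  refine ⟨hint, (integral_mono hint.norm hdom hb).trans ?_⟩
  simp only [Pi.add_apply]
  rw [integral_const_mul, integral_add hi hi2]
  gcongr

theorem abs_deconvKernel_le (hβ : 0 < β) (hc : 0 < c) (hω₀ : 0 < ω₀) (hb : 0 < b)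
    (hτ : 0 < τ) (x : ℝ) {w lam : ℝ} (hw : 0 < w) (hw1 : w ≤ 1) (hw0 : w ≤ ω₀) (hlam : 1 ≤ lam) :
    |deconvKernel ν lam x| ≤ (4 + 2 * b * ((c ^ 2)⁻¹ * 2 ^ β) * τ⁻¹ +
      c⁻¹ * (1 + (w ^ 2)⁻¹) ^ (β / 2) * β⁻¹) * lam ^ β := by
  have h1 := H.abs_deconvKernel_low_le hβ hc hω₀ hb hτ x hw.le hw1 hw0
  have h2 := H.abs_deconvKernel_sub_le hβ hc hω₀ hb hτ x hw (hw1.trans hlam)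
  have h3 := abs_sub_abs_le_abs_sub (deconvKernel ν lam x) (deconvKernel ν w x)
  have h4 : 1 ≤ lam ^ β := Real.one_le_rpow hlam hβ.le
  have h5 : 0 ≤ 4 + 2 * b * ((c ^ 2)⁻¹ * 2 ^ β) * τ⁻¹ := by positivity
  nlinarith

theorem integral_sq_deconvKernel_sub_le (hβ : 0 < β) (hc : 0 < c) (hC : 0 < C) (hω₀ : 0 < ω₀)
    (hb : 0 < b) (hτ : 0 < τ) (hreg : 1 / 2 < α + β) {μ : Measure ℝ}
    (hμ : μ ∈ sobolevClass α L) {w lam : ℝ} (hw : 0 < w) (hlam : w ≤ lam) (t₀ : ℝ) :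
    ∫ y, (deconvKernel ν lam (y - t₀) - deconvKernel ν w (y - t₀)) ^ 2 ∂(μ ∗ ν) ≤
      C / 2 * (2 * Real.pi * L ^ 2 + ∫ ω : ℝ, (1 + ω ^ 2) ^ (-(α + β))) *
        ((c⁻¹ * (1 + (w ^ 2)⁻¹) ^ (β / 2)) ^ 2 * ∫ ω in w..lam, ω ^ (2 * β - 2)) := by
  obtain ⟨hint, hK⟩ := H.integrable_charFun_conv (L := L) hC hreg hμ
  obtain ⟨hp, -, -, -⟩ := sobolevClass_spec hμ
  have hm := measurable_charFun (μ := ν)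
  set m := volume.restrict (Ioc w lam) with hmdef
  set A := c⁻¹ * (1 + (w ^ 2)⁻¹) ^ (β / 2) with hA
  let g : ℝ → ℂ := fun ω => (ω⁻¹ : ℝ) * (Complex.exp ((-(ω * t₀) : ℝ) * Complex.I) / charFun ν ω)
  have hg : Measurable g := by
    simp only [g]
    fun_prop
  have hmem : ∀ᵐ ω ∂m, ω ∈ Ioc w lam := ae_restrict_mem measurableSet_Ioc
  have hgn : ∀ ω, 0 < ω → ‖g ω‖ = ω⁻¹ * ‖charFun ν ω‖⁻¹ := by
    intro ω hω
    simp only [g]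
    rw [norm_mul, norm_div, Complex.norm_exp_ofReal_mul_I, one_div, Complex.norm_real,
      Real.norm_eq_abs, abs_of_pos (inv_pos.2 hω)]
  have hB : ∀ᵐ ω ∂m, ‖g ω‖ ≤ w⁻¹ * (c⁻¹ * (1 + lam ^ 2) ^ (β / 2)) := by
    filter_upwards [hmem] with ω hω
    rw [hgn ω (hw.trans hω.1)]
    have h1 := hω.1.le
    have h2 := H.inv_norm_charFun_le_of_le hβ hc (hw.le.trans h1) hω.2
    gcongr
  have hmain := integral_norm_sq_trigIntegral_le (P := μ ∗ ν) (m := m) Measure.restrict_le_self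
    hg hB hint hK
  have hgsq : ∫ ω, ‖g ω‖ ^ 2 ∂m ≤ A ^ 2 * ∫ ω in w..lam, ω ^ (2 * β - 2) := by
    rw [intervalIntegral.integral_of_le hlam, ← integral_const_mul]
    refine integral_mono_of_nonneg (Eventually.of_forall fun _ => by positivity) ?_ ?_
    · refine Integrable.const_mul ?_ _
      refine (intervalIntegral.intervalIntegrable_rpow (a := w) (b := lam) (Or.inr ?_)).1
      rw [uIcc_of_le hlam]
      exact fun h => absurd h.1 (not_le.2 hw)
    · filter_upwards [hmem] with ω hω
      have hω0 : 0 < ω := hw.trans hω.1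
      have h1 := H.norm_inv_mul_inv_charFun_le hβ hc hw hω.1.le
      rw [hgn ω hω0]
      refine (pow_le_pow_left₀ (by positivity) h1 2).trans_eq ?_
      rw [mul_pow, ← Real.rpow_natCast (_ ^ (β - 1)) 2, ← Real.rpow_mul hω0.le]
      congr 2
      push_cast
      ring
  have hle : ∀ y, (deconvKernel ν lam (y - t₀) - deconvKernel ν w (y - t₀)) ^ 2 ≤
      ‖∫ ω, g ω * Complex.exp ((ω * y : ℝ) * Complex.I) ∂m‖ ^ 2 := by
    intro y
    rw [H.deconvKernel_sub hβ hc hω₀ hb hτ _ hw.le (hw.le.trans hlam),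
      intervalIntegral.integral_of_le hlam]
    have hi : Integrable (fun ω => g ω * Complex.exp ((ω * y : ℝ) * Complex.I)) m := by
      refine Integrable.of_bound (C := w⁻¹ * (c⁻¹ * (1 + lam ^ 2) ^ (β / 2)))
        (Measurable.aestronglyMeasurable (by fun_prop)) ?_
      filter_upwards [hB] with ω hω
      rwa [norm_mul, Complex.norm_exp_ofReal_mul_I, mul_one]
    have e1 : ∫ ω in Ioc w lam, deconvIntegrand ν (y - t₀) ω =
        (∫ ω, g ω * Complex.exp ((ω * y : ℝ) * Complex.I) ∂m).im := by
      refine Eq.trans (integral_congr_ae (Eventually.of_forall fun ω => ?_))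
        (integral_im (𝕜 := ℂ) hi)
      change _ = (g ω * Complex.exp ((ω * y : ℝ) * Complex.I)).im
      have e2 : ((ω * (y - t₀) : ℝ) : ℂ) * Complex.I =
          (-(ω * t₀) : ℝ) * Complex.I + (ω * y : ℝ) * Complex.I := by
        push_cast
        ring
      simp only [deconvIntegrand, g]
      rw [mul_assoc, Complex.im_ofReal_mul, e2, Complex.exp_add, div_mul_eq_mul_div]
    rw [e1, ← sq_abs]
    gcongr
    exact Complex.abs_im_le_norm _
  have hK0 : 0 ≤ ∫ ω, ‖charFun (μ ∗ ν) ω‖ := integral_nonneg fun _ => norm_nonneg _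
  have hbd : ∀ y, ‖∫ ω, g ω * Complex.exp ((ω * y : ℝ) * Complex.I) ∂m‖ ≤
      w⁻¹ * (c⁻¹ * (1 + lam ^ 2) ^ (β / 2)) * m.real univ := by
    intro y
    refine norm_integral_le_of_norm_le_const ?_
    filter_upwards [hB] with ω hω
    rwa [norm_mul, Complex.norm_exp_ofReal_mul_I, mul_one]
  have hmeas : Measurable fun y => ∫ ω, g ω * Complex.exp ((ω * y : ℝ) * Complex.I) ∂m := by
    refine (StronglyMeasurable.integral_prod_right (E := ℂ)
      (f := fun y ω : ℝ => g ω * Complex.exp ((ω * y : ℝ) * Complex.I)) ?_).measurable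
    apply Measurable.stronglyMeasurable
    unfold Function.uncurry
    fun_prop
  refine (integral_mono_of_nonneg (Eventually.of_forall fun _ => sq_nonneg _) ?_
    (Eventually.of_forall hle)).trans (hmain.trans ?_)
  · refine Integrable.of_bound (Measurable.aestronglyMeasurable (by fun_prop))
      ((w⁻¹ * (c⁻¹ * (1 + lam ^ 2) ^ (β / 2)) * m.real univ) ^ 2)
      (Eventually.of_forall fun y => ?_)
    rw [Real.norm_eq_abs, abs_of_nonneg (by positivity)]
    exact pow_le_pow_left₀ (norm_nonneg _) (hbd y) 2
  · have := hK0.trans hK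
    gcongr

theorem integral_sq_deconvKernel_le (hβ : 0 < β) (hc : 0 < c) (hC : 0 < C) (hω₀ : 0 < ω₀)
    (hb : 0 < b) (hτ : 0 < τ) (hreg : 1 / 2 < α + β) {μ : Measure ℝ}
    (hμ : μ ∈ sobolevClass α L) {w lam : ℝ} (hw : 0 < w) (hw1 : w ≤ 1) (hw0 : w ≤ ω₀)
    (hlam : 1 ≤ lam) (t₀ : ℝ) :
    ∫ y, deconvKernel ν lam (y - t₀) ^ 2 ∂(μ ∗ ν) ≤
      2 * (4 + 2 * b * ((c ^ 2)⁻¹ * 2 ^ β) * τ⁻¹) ^ 2 +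
      2 * (C / 2 * (2 * Real.pi * L ^ 2 + ∫ ω : ℝ, (1 + ω ^ 2) ^ (-(α + β))) *
        ((c⁻¹ * (1 + (w ^ 2)⁻¹) ^ (β / 2)) ^ 2 * ∫ ω in w..lam, ω ^ (2 * β - 2))) := by
  obtain ⟨hp, -, -, -⟩ := sobolevClass_spec hμ
  have h1 := H.integral_sq_deconvKernel_sub_le (L := L) hβ hc hC hω₀ hb hτ hreg hμ hw
    (hw1.trans hlam) t₀
  set K₀ := 4 + 2 * b * ((c ^ 2)⁻¹ * 2 ^ β) * τ⁻¹ with hK₀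
  have hmw := measurable_deconvKernel (ν := ν) w
  have hml := measurable_deconvKernel (ν := ν) lam
  have hi : Integrable (fun y => 2 * (deconvKernel ν lam (y - t₀) -
      deconvKernel ν w (y - t₀)) ^ 2) (μ ∗ ν) := by
    refine Integrable.of_bound (Measurable.aestronglyMeasurable (by fun_prop))
      (2 * (c⁻¹ * (1 + (w ^ 2)⁻¹) ^ (β / 2) * (lam ^ β * β⁻¹)) ^ 2)
      (Eventually.of_forall fun y => ?_)
    rw [Real.norm_eq_abs, abs_of_nonneg (by positivity), ← sq_abs]
    have := H.abs_deconvKernel_sub_le hβ hc hω₀ hb hτ (y - t₀) hw (hw1.trans hlam)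
    gcongr
  calc _ ≤ ∫ y, (2 * K₀ ^ 2 + 2 * (deconvKernel ν lam (y - t₀) -
        deconvKernel ν w (y - t₀)) ^ 2) ∂(μ ∗ ν) := by
        refine integral_mono_of_nonneg (Eventually.of_forall fun _ => sq_nonneg _)
          ((integrable_const _).add hi) (Eventually.of_forall fun y => ?_)
        have h2 := H.abs_deconvKernel_low_le hβ hc hω₀ hb hτ (y - t₀) hw.le hw1 hw0
        have h3 : deconvKernel ν w (y - t₀) ^ 2 ≤ K₀ ^ 2 := by
          rw [← sq_abs]
          gcongr
        simp only
        nlinarith [sq_nonneg (deconvKernel ν lam (y - t₀) - 2 * deconvKernel ν w (y - t₀))]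
    _ ≤ _ := by
        rw [integral_add (integrable_const _) hi, integral_const, probReal_univ, one_smul,
          integral_const_mul]
        linarith

end SmoothError

end

/-! ### The bias -/

/-- Gil-Pelaez inversion, written with the sine integral: for a law without atoms at `t₀`,
`E Si (A (X - t₀))` tends to `π/2 - π F(t₀)`. -/
theorem tendsto_integral_sineIntegral {μ : Measure ℝ} [IsProbabilityMeasure μ]
    (hμ : μ ≪ volume) (t₀ : ℝ) :
    Tendsto (fun A : ℝ => ∫ x, sineIntegral (A * (x - t₀)) ∂μ) atTop
      (𝓝 (Real.pi / 2 - Real.pi * cdf μ t₀)) := by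
  have hlim : ∫ x, (Real.pi / 2 - Real.pi * (Iic t₀).indicator 1 x) ∂μ =
      Real.pi / 2 - Real.pi * cdf μ t₀ := by
    have hi : Integrable ((Iic t₀).indicator (1 : ℝ → ℝ)) μ :=
      (integrable_const (1 : ℝ)).indicator measurableSet_Iic
    rw [integral_sub (integrable_const _) (hi.const_mul _), integral_const_mul,
      integral_indicator_one measurableSet_Iic, cdf_eq_real]
    simp
  rw [← hlim]
  refine tendsto_integral_filter_of_dominated_convergence (fun _ => 4)
    (Eventually.of_forall fun A => ?_) (Eventually.of_forall fun A =>
      Eventually.of_forall fun x => abs_sineIntegral_le _) (integrable_const _) ?_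
  · exact (continuous_sineIntegral.comp (by fun_prop)).aestronglyMeasurable
  · have h0 : ∀ᵐ x ∂μ, x ≠ t₀ := by
      have : ∀ᵐ x : ℝ, x ≠ t₀ := by simp [ae_iff, measure_singleton]
      exact hμ.ae_le this
    filter_upwards [h0] with x hx
    rcases lt_or_gt_of_ne hx with h | h
    · have e1 : Tendsto (fun A : ℝ => A * (t₀ - x)) atTop atTop :=
        tendsto_id.atTop_mul_const (by linarith)
      have e2 := (tendsto_sineIntegral_atTop.comp e1).neg
      have e3 : Real.pi / 2 - Real.pi * (Iic t₀).indicator 1 x = -(Real.pi / 2) := by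
        rw [indicator_of_mem (by exact h.le)]
        simp only [Pi.one_apply]
        ring
      rw [e3]
      refine e2.congr fun A => ?_
      simp only [Function.comp]
      rw [← sineIntegral_neg]
      congr 1
      ring
    · have e1 : Tendsto (fun A : ℝ => A * (x - t₀)) atTop atTop :=
        tendsto_id.atTop_mul_const (by linarith)
      rw [indicator_of_notMem (by exact not_le.2 h), mul_zero, sub_zero]
      exact tendsto_sineIntegral_atTop.comp e1

theorem abs_integral_sin_le_norm_charFun {μ : Measure ℝ} [IsProbabilityMeasure μ] (t₀ ω : ℝ) :
    |∫ x, Real.sin (ω * (x - t₀)) ∂μ| ≤ ‖charFun μ ω‖ := by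
  have h1 : ∫ x, Real.sin (ω * (x - t₀)) ∂μ = -∫ x, Real.sin (ω * (t₀ - x)) ∂μ := by
    rw [← integral_neg]
    refine integral_congr_ae (Eventually.of_forall fun x => ?_)
    simp only [← Real.sin_neg]
    congr 1
    ring
  rw [h1, abs_neg, ← im_cexp_mul_conj_charFun]
  refine (Complex.abs_im_le_norm _).trans_eq ?_
  rw [norm_mul, Complex.norm_exp_ofReal_mul_I, one_mul, RCLike.norm_conj]

theorem one_add_sq_rpow_neg_le (α : ℝ) {ω : ℝ} (hω : 1 ≤ ω) :
    (1 + ω ^ 2) ^ (-α) ≤ 2 ^ |α| * ω ^ (-(2 * α)) := by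
  have h0 : 0 < ω := by linarith
  have h1 : ω ^ (-(2 * α)) = (ω ^ 2) ^ (-α) := by
    rw [← Real.rpow_natCast ω 2, ← Real.rpow_mul h0.le]
    congr 1
    push_cast
    ring
  rw [h1]
  rcases le_total 0 α with h | h
  · have h2 : (1 + ω ^ 2) ^ (-α) ≤ (ω ^ 2) ^ (-α) :=
      Real.rpow_le_rpow_of_nonpos (by positivity) (by linarith) (by linarith)
    have h3 : (1 : ℝ) ≤ 2 ^ |α| := Real.one_le_rpow (by norm_num) (abs_nonneg _)
    have h4 : 0 ≤ (ω ^ 2) ^ (-α) := by positivity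
    nlinarith
  · rw [abs_of_nonpos h, ← Real.mul_rpow (by norm_num) (by positivity)]
    refine Real.rpow_le_rpow (by positivity) ?_ (by linarith)
    nlinarith

/-- The truncation of the inversion integral at `lam` costs `O(lam^(-(α + 1/2)))` over the Sobolev
class. -/
theorem abs_bias_le {α L : ℝ} (hα : -(1 / 2) < α) {μ : Measure ℝ} (hμ : μ ∈ sobolevClass α L)
    (t₀ : ℝ) {lam : ℝ} (hlam : 1 ≤ lam) :
    |Real.pi / 2 - Real.pi * cdf μ t₀ - ∫ x, sineIntegral (lam * (x - t₀)) ∂μ| ≤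
      (Real.pi * L ^ 2 + 2 ^ |α| / (2 * (2 * α + 1))) * lam ^ (-(α + 1 / 2)) := by
  obtain ⟨hp, hac, hi, hle⟩ := sobolevClass_spec hμ
  have hlam0 : 0 < lam := by linarith
  refine le_of_tendsto (((tendsto_integral_sineIntegral hac t₀).sub_const
    (∫ x, sineIntegral (lam * (x - t₀)) ∂μ)).abs) ?_
  filter_upwards [eventually_ge_atTop lam] with A hA
  have hsi : ∀ B : ℝ, Integrable (fun x => sineIntegral (B * (x - t₀))) μ := fun B =>
    Integrable.of_bound (continuous_sineIntegral.comp (by fun_prop)).aestronglyMeasurable 4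
      (Eventually.of_forall fun x => abs_sineIntegral_le _)
  have hF : Integrable (Function.uncurry fun ω x : ℝ => ω⁻¹ * Real.sin (ω * (x - t₀)))
      ((volume.restrict (Ioc lam A)).prod μ) := by
    refine Integrable.of_bound (C := 1)
      (Measurable.aestronglyMeasurable (by unfold Function.uncurry; fun_prop)) ?_
    have h1 : ∀ᵐ ω ∂(volume.restrict (Ioc lam A)), ω ∈ Ioc lam A :=
      ae_restrict_mem measurableSet_Ioc
    filter_upwards [Measure.quasiMeasurePreserving_fst.ae h1] with p hp
    have h2 : 1 ≤ p.1 := hlam.trans hp.1.le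
    rw [Function.uncurry, norm_mul, Real.norm_eq_abs, Real.norm_eq_abs, abs_of_nonneg (by positivity)]
    exact mul_le_one₀ (inv_le_one_of_one_le₀ h2) (abs_nonneg _) (Real.abs_sin_le_one _)
  have hswap := integral_integral_swap hF
  simp only [integral_const_mul] at hswap
  have hdiff : ∫ x, sineIntegral (A * (x - t₀)) ∂μ - ∫ x, sineIntegral (lam * (x - t₀)) ∂μ =
      ∫ ω in Ioc lam A, ω⁻¹ * ∫ x, Real.sin (ω * (x - t₀)) ∂μ := by
    rw [hswap, ← integral_sub (hsi A) (hsi lam)]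
    refine integral_congr_ae (Eventually.of_forall fun x => ?_)
    simp only
    rw [← integral_inv_mul_sin, intervalIntegral.integral_of_le hA]
  -- the weight `κ` balances the two terms of the arithmetic-geometric mean inequality below
  set κ := lam ^ (-(α + 1 / 2)) with hκ
  have hκ0 : 0 < κ := by positivity
  have hκ2 : κ⁻¹ * lam ^ (-(2 * α + 1)) = κ := by
    rw [hκ, ← Real.rpow_neg hlam0.le, ← Real.rpow_add hlam0]
    congr 1
    ring
  have hi2 : IntegrableOn (fun ω : ℝ => ω ^ (-(2 * α + 2))) (Ioc lam A) := by
    refine (intervalIntegral.intervalIntegrable_rpow (a := lam) (b := A) (Or.inr ?_)).1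
    rw [uIcc_of_le hA]
    exact fun h => absurd h.1 (not_le.2 hlam0)
  have hi1 : IntegrableOn (fun ω : ℝ => ‖charFun μ ω‖ ^ 2 * (1 + ω ^ 2) ^ α) (Ioc lam A) :=
    hi.integrableOn
  have hdom := (hi1.const_mul (κ / 2)).add
    (hi2.const_mul (κ⁻¹ / 2 * 2 ^ |α|))
  rw [hdiff]
  refine (norm_integral_le_of_norm_le (f := fun ω => ω⁻¹ * ∫ x, Real.sin (ω * (x - t₀)) ∂μ)
    hdom ?_).trans ?_
  · filter_upwards [ae_restrict_mem measurableSet_Ioc] with ω hω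
    have h1 : 1 ≤ ω := hlam.trans hω.1.le
    have h0 : 0 < ω := by linarith
    have hq : 0 < 1 + ω ^ 2 := by positivity
    have h2 := abs_integral_sin_le_norm_charFun (μ := μ) t₀ ω
    have h3 := one_add_sq_rpow_neg_le α h1
    rw [norm_mul, Real.norm_eq_abs, Real.norm_eq_abs, abs_of_pos (inv_pos.2 h0)]
    simp only [Pi.add_apply]
    set u := (1 + ω ^ 2) ^ (α / 2) with hu
    set v := ω⁻¹ * (1 + ω ^ 2) ^ (-α / 2) with hv
    have e1 : u * v = ω⁻¹ := by
      rw [hu, hv, mul_left_comm, ← Real.rpow_add hq]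
      have : α / 2 + -α / 2 = 0 := by ring
      rw [this, Real.rpow_zero, mul_one]
    have e2 : (1 + ω ^ 2) ^ α = u * u := by
      rw [hu, ← Real.rpow_add hq]
      congr 1
      ring
    have e3 : v * v ≤ 2 ^ |α| * ω ^ (-(2 * α + 2)) := by
      have e4 : v * v = ω⁻¹ * ω⁻¹ * (1 + ω ^ 2) ^ (-α) := by
        rw [hv, mul_mul_mul_comm, ← Real.rpow_add hq]
        congr 2
        ring
      have e5 : ω ^ (-(2 * α + 2)) = ω⁻¹ * ω⁻¹ * ω ^ (-(2 * α)) := by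
        rw [neg_add, Real.rpow_add h0, Real.rpow_neg h0.le 2]
        norm_num
        field_simp
      rw [e4, e5]
      have : 0 ≤ ω⁻¹ * ω⁻¹ := by positivity
      nlinarith
    have e6 : κ⁻¹ * (v * v) ≤ κ⁻¹ * (2 ^ |α| * ω ^ (-(2 * α + 2))) := by gcongr
    have e7 : ω⁻¹ * |∫ x, Real.sin (ω * (x - t₀)) ∂μ| ≤ u * v * ‖charFun μ ω‖ := by
      rw [e1]
      gcongr
    have e8 : 0 ≤ κ⁻¹ * (κ * (‖charFun μ ω‖ * u) - v) ^ 2 := by positivity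
    have e9 : κ⁻¹ * (κ * (‖charFun μ ω‖ * u) - v) ^ 2 = κ * (‖charFun μ ω‖ ^ 2 * (u * u)) -
        2 * (u * v * ‖charFun μ ω‖) + κ⁻¹ * (v * v) := by
      field_simp
      ring
    rw [e2]
    linarith
  · simp only [Pi.add_apply]
    rw [integral_add (hi1.const_mul _) (hi2.const_mul _), integral_const_mul,
      integral_const_mul]
    have h1 : ∫ ω in Ioc lam A, ‖charFun μ ω‖ ^ 2 * (1 + ω ^ 2) ^ α ≤ 2 * Real.pi * L ^ 2 :=
      (setIntegral_le_integral hi (Eventually.of_forall fun ω => by positivity)).trans hle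
    have h2 : ∫ ω in Ioc lam A, ω ^ (-(2 * α + 2)) ≤ lam ^ (-(2 * α + 1)) / (2 * α + 1) := by
      rw [← intervalIntegral.integral_of_le hA, integral_rpow (Or.inr ⟨by linarith, by
        rw [uIcc_of_le hA]; exact fun h => absurd h.1 (not_le.2 hlam0)⟩)]
      have e1 : -(2 * α + 2) + 1 = -(2 * α + 1) := by ring
      have e2 : 0 ≤ A ^ (-(2 * α + 1)) := Real.rpow_nonneg (hlam0.le.trans hA) _
      rw [e1, div_neg, ← neg_div]
      have : 0 < 2 * α + 1 := by linarith
      gcongr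
      linarith
    have h3 : 0 < 2 * α + 1 := by linarith
    calc _ ≤ κ / 2 * (2 * Real.pi * L ^ 2) +
          κ⁻¹ / 2 * 2 ^ |α| * (lam ^ (-(2 * α + 1)) / (2 * α + 1)) := by gcongr
      _ = κ * (Real.pi * L ^ 2) +
          (κ⁻¹ * lam ^ (-(2 * α + 1))) * (2 ^ |α| / (2 * (2 * α + 1))) := by
          field_simp
      _ = _ := by
          rw [hκ2]
          ring

/-- The mean of the kernel over the observations. -/
theorem SmoothError.integral_deconvKernel_conv {ν : Measure ℝ} [IsProbabilityMeasure ν]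
    {β c C ω₀ b τ : ℝ} (H : SmoothError ν β c C ω₀ b τ) (hβ : 0 < β) (hc : 0 < c) (hω₀ : 0 < ω₀)
    (hb : 0 < b) (hτ : 0 < τ) {μ : Measure ℝ} [IsProbabilityMeasure μ] {lam M : ℝ}
    (hlam : 0 ≤ lam) (hM : ∀ x, |deconvKernel ν lam x| ≤ M) (t₀ : ℝ) :
    ∫ y, deconvKernel ν lam (y - t₀) ∂(μ ∗ ν) = ∫ x, sineIntegral (lam * (x - t₀)) ∂μ := by
  have hm := measurable_deconvKernel (ν := ν) lam
  rw [integral_conv (Integrable.of_bound (Measurable.aestronglyMeasurable (by fun_prop)) M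
    (Eventually.of_forall fun y => hM _))]
  refine integral_congr_ae (Eventually.of_forall fun x => ?_)
  simp only
  rw [← H.integral_deconvKernel_add hβ hc hω₀ hb hτ hlam (x - t₀)]
  refine integral_congr_ae (Eventually.of_forall fun ζ => ?_)
  simp only
  congr 1
  ring

/-! ### Empirical means of bounded functions -/

section

variable {P : Measure ℝ} [IsProbabilityMeasure P] {G : ℝ → ℝ} {M V : ℝ}

/-- Quadratic error of an empirical mean shifted by a deterministic bias `B`. -/
theorem lintegral_sq_mean_sub_le (hG : Measurable G) (hM : ∀ y, |G y| ≤ M)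
    (hV : ∫ y, G y ^ 2 ∂P ≤ V) {n : ℕ} (hn : 0 < n) (B : ℝ) :
    ∫⁻ y : Fin n → ℝ, ENNReal.ofReal (|B + (1 / n * ∑ j, G (y j) - ∫ y, G y ∂P)| ^ 2)
        ∂(Measure.pi fun _ => P) ≤ ENNReal.ofReal (2 * B ^ 2 + 2 * (V / n)) := by
  have hn' : (0 : ℝ) < n := by exact_mod_cast hn
  have hLp : MemLp G 2 P := MemLp.of_bound hG.aestronglyMeasurable M (Eventually.of_forall hM)
  have hLp' : ∀ j : Fin n, MemLp (fun y : Fin n → ℝ => G (y j)) 2 (Measure.pi fun _ => P) :=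
    fun j => MemLp.of_bound (Measurable.aestronglyMeasurable (by fun_prop)) M
      (Eventually.of_forall fun y => hM _)
  set S : (Fin n → ℝ) → ℝ := ∑ j, fun y => G (y j) with hS
  have hSapp : ∀ y, S y = ∑ j, G (y j) := fun y => by simp [hS]
  have hSLp : MemLp S 2 (Measure.pi fun _ => P) := memLp_finsetSum' _ fun j _ => hLp' j
  have hmean : ∫ y, S y ∂(Measure.pi fun _ => P) = n * ∫ y, G y ∂P := by
    simp only [hSapp]
    rw [integral_finsetSum _ fun j _ => (hLp' j).integrable one_le_two]
    simp only [integral_comp_eval (μ := fun _ : Fin n => P) hG.aestronglyMeasurable]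
    simp
  have hvar : ∫ y, (S y - n * ∫ y, G y ∂P) ^ 2 ∂(Measure.pi fun _ => P) ≤ n * V := by
    rw [← hmean, ← variance_eq_integral hSLp.aestronglyMeasurable.aemeasurable, hS,
      variance_sum_pi (fun _ => hLp)]
    simp only [Finset.sum_const, Finset.card_univ, Fintype.card_fin, nsmul_eq_mul]
    gcongr
    refine le_trans (variance_le_expectation_sq hG.aestronglyMeasurable) ?_
    simpa using hV
  have hint : Integrable (fun y => (S y - n * ∫ y, G y ∂P) ^ 2) (Measure.pi fun _ => P) :=
    (hSLp.sub (memLp_const _)).integrable_sq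
  have hint2 : Integrable (fun y => 2 * B ^ 2 + 2 / n ^ 2 * (S y - n * ∫ y, G y ∂P) ^ 2)
      (Measure.pi fun _ => P) := (integrable_const _).add (hint.const_mul _)
  have hpt : ∀ y : Fin n → ℝ, |B + (1 / n * ∑ j, G (y j) - ∫ y, G y ∂P)| ^ 2 ≤
      2 * B ^ 2 + 2 / n ^ 2 * (S y - n * ∫ y, G y ∂P) ^ 2 := by
    intro y
    have e1 : 1 / n * ∑ j, G (y j) - ∫ y, G y ∂P = 1 / n * (S y - n * ∫ y, G y ∂P) := by
      rw [hSapp]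
      field_simp
    have e2 : 2 / (n : ℝ) ^ 2 * (S y - n * ∫ y, G y ∂P) ^ 2 =
        2 * (1 / n * (S y - n * ∫ y, G y ∂P)) ^ 2 := by
      field_simp
    rw [sq_abs, e1, e2]
    nlinarith [sq_nonneg (B - 1 / n * (S y - n * ∫ y, G y ∂P))]
  refine (lintegral_mono fun y => ENNReal.ofReal_le_ofReal (hpt y)).trans ?_
  rw [← ofReal_integral_eq_lintegral_ofReal hint2 (Eventually.of_forall fun y => by positivity)]
  refine ENNReal.ofReal_le_ofReal ?_
  rw [integral_add (integrable_const _) (hint.const_mul _), integral_const, probReal_univ, one_smul,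
    integral_const_mul]
  have e3 : 2 * (V / n) = 2 / (n : ℝ) ^ 2 * (n * V) := by
    field_simp
  rw [e3]
  gcongr

/-- The moment bound behind Bernstein's inequality, from `eˣ ≤ 1 + x + x²` for `|x| ≤ 1`. -/
theorem mgf_le_of_centered (hG : Measurable G) (hM : ∀ y, |G y| ≤ M) (h0 : ∫ y, G y ∂P = 0)
    (hV : ∫ y, G y ^ 2 ∂P ≤ V) {s : ℝ} (hs : 0 ≤ s) (hsM : s * M ≤ 1) :
    mgf G P s ≤ Real.exp (s ^ 2 * V) := by
  have hpt : ∀ y, Real.exp (s * G y) ≤ 1 + s * G y + s ^ 2 * G y ^ 2 := by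
    intro y
    have h1 : |s * G y| ≤ 1 := by
      rw [abs_mul, abs_of_nonneg hs]
      exact (mul_le_mul_of_nonneg_left (hM y) hs).trans hsM
    have h2 := (abs_le.1 (Real.abs_exp_sub_one_sub_id_le h1)).2
    rw [mul_pow] at h2
    linarith
  have hi : Integrable G P :=
    Integrable.of_bound hG.aestronglyMeasurable M (Eventually.of_forall hM)
  have hi2 : Integrable (fun y => G y ^ 2) P := by
    refine Integrable.of_bound (Measurable.aestronglyMeasurable (by fun_prop)) (M ^ 2)
      (Eventually.of_forall fun y => ?_)
    rw [Real.norm_eq_abs, abs_of_nonneg (sq_nonneg _), ← sq_abs]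
    have := hM y
    gcongr
  have hi3 : Integrable (fun y => 1 + s * G y) P := (integrable_const _).add (hi.const_mul _)
  calc mgf G P s ≤ ∫ y, (1 + s * G y + s ^ 2 * G y ^ 2) ∂P :=
        integral_mono_of_nonneg (Eventually.of_forall fun y => (Real.exp_pos _).le)
          (hi3.add (hi2.const_mul _)) (Eventually.of_forall hpt)
    _ = 1 + s ^ 2 * ∫ y, G y ^ 2 ∂P := by
        rw [integral_add hi3 (hi2.const_mul _), integral_add (integrable_const _) (hi.const_mul _),
          integral_const_mul, integral_const_mul, h0]
        simp
    _ ≤ 1 + s ^ 2 * V := by gcongr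
    _ ≤ _ := by
        rw [add_comm]
        exact Real.add_one_le_exp _

/-- One-sided Bernstein inequality for a centered bounded function. -/
theorem measure_sum_ge_le (hG : Measurable G) (hM : ∀ y, |G y| ≤ M) (h0 : ∫ y, G y ∂P = 0)
    (hV : ∫ y, G y ^ 2 ∂P ≤ V) (hM0 : 0 < M) (n : ℕ) {z : ℝ} (hz : 0 < z) :
    (Measure.pi fun _ : Fin n => P).real
        {y | n * (2 * (M / z + Real.sqrt (V / z))) ≤ ∑ j, G (y j)} ≤ Real.exp (-(n / z)) := by
  have hV0 : 0 ≤ V := (integral_nonneg fun _ => sq_nonneg _).trans hV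
  set r := Real.sqrt (V / z) with hr
  have hr2 : r * r = V / z := Real.mul_self_sqrt (by positivity)
  have hr0 : 0 ≤ r := Real.sqrt_nonneg _
  -- `s` is chosen so that `s M ≤ 1` and `s² V ≤ 1 / z`, while `s` times the threshold is `2 / z`
  set s := (M + z * r)⁻¹ with hs
  have hd : 0 < M + z * r := by positivity
  have hs0 : 0 < s := inv_pos.2 hd
  have hsM : s * M ≤ 1 := by
    rw [hs, inv_mul_le_one₀ hd]
    linarith [mul_nonneg hz.le hr0]
  have hsV : s ^ 2 * V ≤ 1 / z := by
    have e1 : V = z * (r * r) := by rw [hr2]; field_simp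
    have e2 : s * (z * r) ≤ 1 := by
      rw [hs, inv_mul_le_one₀ hd]
      linarith
    have e3 : s ^ 2 * V = (s * (z * r)) ^ 2 / z := by
      rw [e1]
      field_simp
    rw [e3]
    gcongr
    exact pow_le_one₀ (by positivity) e2
  have hst : s * (2 * (M / z + r)) = 2 / z := by
    have : M / z + r = (M + z * r) / z := by field_simp
    rw [this, hs]
    field_simp
  have hmeas : ∀ j : Fin n, Measurable fun y : Fin n → ℝ => G (y j) := fun j => by fun_prop
  have hind : iIndepFun (fun (j : Fin n) (y : Fin n → ℝ) => G (y j)) (Measure.pi fun _ => P) :=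
    iIndepFun_pi (μ := fun _ => P) (X := fun _ => G) fun _ => hG.aemeasurable
  have hmgf : mgf (∑ j, fun y : Fin n → ℝ => G (y j)) (Measure.pi fun _ => P) s ≤
      Real.exp (n * (1 / z)) := by
    rw [hind.mgf_sum hmeas]
    have e1 : ∀ j : Fin n, mgf (fun y : Fin n → ℝ => G (y j)) (Measure.pi fun _ => P) s =
        mgf G P s := by
      intro j
      exact integral_comp_eval (μ := fun _ : Fin n => P) (f := fun y => Real.exp (s * G y))
        (Measurable.aestronglyMeasurable (by fun_prop))
    simp only [e1, Finset.prod_const, Finset.card_univ, Fintype.card_fin]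
    rw [Real.exp_nat_mul]
    gcongr
    · exact mgf_nonneg
    · exact (mgf_le_of_centered hG hM h0 hV hs0.le hsM).trans (Real.exp_le_exp.2 hsV)
  have hint : Integrable (fun y : Fin n → ℝ => Real.exp (s * (∑ j, fun y => G (y j) :
      (Fin n → ℝ) → ℝ) y)) (Measure.pi fun _ => P) := by
    refine Integrable.of_bound (Measurable.aestronglyMeasurable ?_) (Real.exp (s * (n * M)))
      (Eventually.of_forall fun y => ?_)
    · simp only [Finset.sum_apply]
      fun_prop
    · rw [Real.norm_eq_abs, Real.abs_exp, Finset.sum_apply]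
      gcongr
      calc ∑ j, G (y j) ≤ ∑ _j : Fin n, M := Finset.sum_le_sum fun j _ => (abs_le.1 (hM _)).2
        _ = n * M := by simp
  have h := measure_ge_le_exp_mul_mgf (n * (2 * (M / z + r))) hs0.le hint
  simp only [Finset.sum_apply] at h
  refine h.trans ((mul_le_mul_of_nonneg_left hmgf (Real.exp_pos _).le).trans_eq ?_)
  rw [← Real.exp_add]
  congr 1
  have e1 : -s * (n * (2 * (M / z + r))) = -(n * (s * (2 * (M / z + r)))) := by ring
  rw [e1, hst]
  ring

/-- Two-sided Bernstein inequality for the deviation of an empirical mean. -/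
theorem measure_abs_mean_sub_gt_le (hG : Measurable G) (hM : ∀ y, |G y| ≤ M) (hM0 : 0 < M)
    (hV : ∫ y, G y ^ 2 ∂P ≤ V) {n : ℕ} (hn : 0 < n) {z : ℝ} (hz : 0 < z) :
    (Measure.pi fun _ : Fin n => P).real
        {y | 2 * (2 * M / z + Real.sqrt (V / z)) < |1 / n * ∑ j, G (y j) - ∫ y, G y ∂P|} ≤
      2 * Real.exp (-(n / z)) := by
  have hn' : (0 : ℝ) < n := by exact_mod_cast hn
  have hi : Integrable G P :=
    Integrable.of_bound hG.aestronglyMeasurable M (Eventually.of_forall hM)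
  have hLp : MemLp G 2 P := MemLp.of_bound hG.aestronglyMeasurable M (Eventually.of_forall hM)
  set m := ∫ y, G y ∂P with hm
  have hmM : |m| ≤ M := by
    have := norm_integral_le_of_norm_le_const (μ := P) (f := G) (C := M) (Eventually.of_forall hM)
    simpa using this
  have hV1 : ∫ y, (G y - m) ^ 2 ∂P ≤ V := by
    rw [hm, ← variance_eq_integral hG.aemeasurable]
    refine le_trans (variance_le_expectation_sq hG.aestronglyMeasurable) ?_
    simpa using hV
  have hM1 : ∀ y, |G y - m| ≤ 2 * M := fun y => by
    have := abs_sub (G y) m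
    linarith [hM y]
  have h01 : ∫ y, (G y - m) ∂P = 0 := by
    rw [integral_sub hi (integrable_const _)]
    simp [hm]
  have hup := measure_sum_ge_le (P := P) (G := fun y => G y - m) (by fun_prop) hM1 h01 hV1
    (by positivity) n hz
  have hdown := measure_sum_ge_le (P := P) (G := fun y => -(G y - m)) (by fun_prop)
    (fun y => by rw [abs_neg]; exact hM1 y) (by rw [integral_neg, h01, neg_zero])
    (by simpa only [neg_sq] using hV1) (by positivity) n hz
  set t := 2 * (2 * M / z + Real.sqrt (V / z)) with ht
  have hsub : {y : Fin n → ℝ | t < |1 / n * ∑ j, G (y j) - m|} ⊆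
      {y | n * t ≤ ∑ j, (G (y j) - m)} ∪ {y | n * t ≤ ∑ j, -(G (y j) - m)} := by
    intro y hy
    have e1 : ∑ j, (G (y j) - m) = n * (1 / n * ∑ j, G (y j) - m) := by
      rw [Finset.sum_sub_distrib]
      simp only [Finset.sum_const, Finset.card_univ, Fintype.card_fin, nsmul_eq_mul]
      field_simp
    have hy' : t < |1 / n * ∑ j, G (y j) - m| := hy
    simp only [mem_union, mem_ofPred_eq, Finset.sum_neg_distrib]
    rw [e1]
    rcases lt_abs.1 hy' with h | h
    · left
      gcongr
    · right
      rw [← mul_neg]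
      gcongr
  calc _ ≤ _ := measureReal_mono hsub
    _ ≤ _ := measureReal_union_le _ _
    _ ≤ _ := by linarith

end

/-! ### Rates -/

section

variable {α β z : ℝ}

theorem max_two_mul_of_le (hβ : β ≤ 1 / 2) : max (2 * β) 1 = 1 := max_eq_right (by linarith)

theorem max_two_mul_of_gt (hβ : 1 / 2 < β) : max (2 * β) 1 = 2 * β := max_eq_left (by linarith)

theorem one_le_bandwidth (hα : -(1 / 2) < α) (hz : 1 ≤ z) : 1 ≤ bandwidth α β z := by
  have : 1 ≤ max (2 * β) 1 := le_max_right _ _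
  exact Real.one_le_rpow hz (one_div_nonneg.2 (by linarith))

theorem bandwidth_rpow (hz : 0 ≤ z) (p : ℝ) :
    bandwidth α β z ^ p = z ^ (p / (2 * α + max (2 * β) 1)) := by
  rw [bandwidth, ← Real.rpow_mul hz]
  congr 1
  ring

theorem rate_of_gt (hβ : 1 / 2 < β) : rate α β z = z ^ (-(2 * α + 1) / (4 * α + 4 * β)) :=
  if_pos hβ

theorem one_le_log (hz : Real.exp 1 ≤ z) : 1 ≤ Real.log z := by
  rwa [Real.le_log_iff_exp_le ((Real.exp_pos 1).trans_le hz)]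

theorem one_le_of_exp_one_le (hz : Real.exp 1 ≤ z) : 1 ≤ z :=
  (Real.one_le_exp zero_le_one).trans hz

/-- For `β ≤ 1/2` the rate is at least the parametric one; at `β = 1/2` this uses `ln z ≥ 1`. -/
theorem rpow_neg_half_le_rate (hβ : β ≤ 1 / 2) (hz : Real.exp 1 ≤ z) :
    z ^ (-(1 / 2) : ℝ) ≤ rate α β z := by
  have hz1 := one_le_of_exp_one_le hz
  have e1 : z ^ (-(1 / 2) : ℝ) = Real.sqrt (1 / z) := by
    rw [Real.rpow_neg (by linarith), ← Real.sqrt_eq_rpow, one_div, Real.sqrt_inv]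
  rw [e1, rate, if_neg (not_lt.2 hβ)]
  split_ifs with h
  · apply Real.sqrt_le_sqrt
    gcongr
    exact one_le_log hz
  · rw [Real.sqrt_div zero_le_one, Real.sqrt_one]

theorem rate_pos (hz : Real.exp 1 ≤ z) : 0 < rate α β z := by
  have hz0 : 0 < z := (Real.exp_pos 1).trans_le hz
  rcases lt_or_ge (1 / 2) β with h | h
  · rw [rate_of_gt h]
    positivity
  · have : 0 < z ^ (-(1 / 2) : ℝ) := by positivity
    exact this.trans_le (rpow_neg_half_le_rate h hz)

theorem bandwidth_rpow_neg_le_rate (hα : -(1 / 2) < α) (hz : Real.exp 1 ≤ z) :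
    bandwidth α β z ^ (-(α + 1 / 2)) ≤ rate α β z := by
  have hz1 := one_le_of_exp_one_le hz
  rw [bandwidth_rpow (by linarith)]
  rcases lt_or_ge (1 / 2) β with h | h
  · rw [max_two_mul_of_gt h, rate_of_gt h]
    apply le_of_eq
    congr 1
    have : α + β ≠ 0 := by linarith
    field_simp
    ring
  · rw [max_two_mul_of_le h]
    refine le_trans (le_of_eq ?_) (rpow_neg_half_le_rate h hz)
    congr 1
    rw [div_eq_iff (by linarith)]
    ring

theorem bandwidth_rpow_le_mul_rate (hreg : 1 / 2 < α + β) (hz : Real.exp 1 ≤ z) :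
    bandwidth α β z ^ β ≤ z * rate α β z := by
  have hz1 := one_le_of_exp_one_le hz
  have hz0 : 0 < z := by linarith
  rw [bandwidth_rpow (by linarith)]
  rcases lt_or_ge (1 / 2) β with h | h
  · rw [max_two_mul_of_gt h, rate_of_gt h]
    nth_rewrite 2 [← Real.rpow_one z]
    rw [← Real.rpow_add hz0]
    apply Real.rpow_le_rpow_of_exponent_le hz1
    have h1 : 0 < 4 * α + 4 * β := by linarith
    have e1 : β / (2 * α + 2 * β) = 2 * β / (4 * α + 4 * β) := by
      have : α + β ≠ 0 := by linarith
      field_simp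
      ring
    have e2 : 1 + -(2 * α + 1) / (4 * α + 4 * β) = (2 * α + 4 * β - 1) / (4 * α + 4 * β) := by
      have : α + β ≠ 0 := by linarith
      field_simp
      ring
    rw [e1, e2]
    gcongr
    linarith
  · refine le_trans ?_ (mul_le_mul_of_nonneg_left (rpow_neg_half_le_rate h hz) hz0.le)
    rw [max_two_mul_of_le h]
    nth_rewrite 2 [← Real.rpow_one z]
    rw [← Real.rpow_add hz0]
    apply Real.rpow_le_rpow_of_exponent_le hz1
    rw [div_le_iff₀ (by linarith)]
    linarith

/-- The three regimes of the second moment of the kernel: a power of the bandwidth, a logarithm, or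
a constant, according to the position of `β` relative to `1/2`. -/
theorem exists_variance_le_rate (hα : -(1 / 2) < α) {w : ℝ} (hw : 0 < w)
    (hw1 : w ≤ 1) : ∃ A : ℝ, 0 < A ∧ ∀ z : ℝ, Real.exp 1 ≤ z →
      1 + ∫ ω in w..bandwidth α β z, ω ^ (2 * β - 2) ≤ A * (z * rate α β z ^ 2) := by
  have hnot : ∀ {lam : ℝ}, 1 ≤ lam → (0 : ℝ) ∉ uIcc w lam := fun {lam} hlam => by
    rw [uIcc_of_le (hw1.trans hlam)]
    exact fun h => absurd h.1 (not_le.2 hw)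
  rcases lt_trichotomy β (1 / 2) with h | h | h
  · refine ⟨1 + w ^ (2 * β - 1) / (1 - 2 * β), ?_, fun z hz => ?_⟩
    · have : 0 < 1 - 2 * β := by linarith
      positivity
    · have hz1 := one_le_of_exp_one_le hz
      have hlam := one_le_bandwidth (β := β) hα hz1
      have hr : rate α β z = 1 / Real.sqrt z := by
        rw [rate, if_neg (by linarith), if_neg h.ne]
      have e1 : z * rate α β z ^ 2 = 1 := by
        rw [hr, div_pow, Real.sq_sqrt (by linarith), one_pow, mul_one_div_cancel (by linarith)]
      have e2 : 2 * β - 2 + 1 = 2 * β - 1 := by ring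
      rw [e1, mul_one, integral_rpow (Or.inr ⟨by linarith, hnot hlam⟩), e2, ← neg_div_neg_eq,
        neg_sub, neg_sub]
      have e3 : 0 ≤ bandwidth α β z ^ (2 * β - 1) := Real.rpow_nonneg (by linarith) _
      have : 0 < 1 - 2 * β := by linarith
      gcongr
      linarith
  · subst h
    refine ⟨1 + 1 / (2 * α + 1) + |Real.log w|, ?_, fun z hz => ?_⟩
    · have : 0 < 2 * α + 1 := by linarith
      positivity
    · have hz1 := one_le_of_exp_one_le hz
      have hlam := one_le_bandwidth (β := 1 / 2) hα hz1
      have hlog := one_le_log hz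
      have hr : rate α (1 / 2) z = Real.sqrt (Real.log z / z) := by
        rw [rate, if_neg (by linarith), if_pos rfl]
      have e1 : z * rate α (1 / 2) z ^ 2 = Real.log z := by
        rw [hr, Real.sq_sqrt (by positivity)]
        field_simp
      have e2 : ∀ ω : ℝ, ω ^ (2 * (1 / 2) - 2 : ℝ) = ω⁻¹ := fun ω => by
        rw [← Real.rpow_neg_one]
        norm_num
      simp only [e2]
      rw [e1, integral_inv (hnot hlam), Real.log_div (by linarith) hw.ne', bandwidth,
        max_two_mul_of_le le_rfl, Real.log_rpow (by linarith)]
      have e3 := neg_abs_le (Real.log w)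
      have e4 := mul_le_mul_of_nonneg_left hlog (abs_nonneg (Real.log w))
      linarith
  · refine ⟨1 + 1 / (2 * β - 1), ?_, fun z hz => ?_⟩
    · have : 0 < 2 * β - 1 := by linarith
      positivity
    · have hz1 := one_le_of_exp_one_le hz
      have hz0 : 0 < z := by linarith
      have hlam := one_le_bandwidth (β := β) hα hz1
      have e1 : z * rate α β z ^ 2 = bandwidth α β z ^ (2 * β - 1) := by
        rw [rate_of_gt h, bandwidth_rpow hz0.le, max_two_mul_of_gt h]
        nth_rewrite 1 [← Real.rpow_one z]
        rw [← Real.rpow_natCast, ← Real.rpow_mul hz0.le, ← Real.rpow_add hz0]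
        congr 1
        have : α + β ≠ 0 := by linarith
        push_cast
        field_simp
        ring
      have e2 : 1 ≤ bandwidth α β z ^ (2 * β - 1) := Real.one_le_rpow hlam (by linarith)
      have e3 : 2 * β - 2 + 1 = 2 * β - 1 := by ring
      rw [e1, integral_rpow (Or.inl (by linarith)), e3, add_mul, one_mul, one_div_mul_eq_div]
      have e4 : 0 ≤ w ^ (2 * β - 1) := by positivity
      have : 0 < 2 * β - 1 := by linarith
      gcongr
      linarith

end

/-! ### Risk bounds -/

section

variable {α β L c C ω₀ b τ : ℝ}

/-- Sup norm, second moment and bias of the kernel at the bandwidth `λ(z)`, all expressed through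
the rate and with one constant for the whole class of error laws and of target laws. -/
theorem exists_kernel_bounds (hα : -(1 / 2) < α) (hβ : 0 < β) (hreg : 1 / 2 < α + β)
    (hc : 0 < c) (hC : 0 < C) (hω₀ : 0 < ω₀) (hb : 0 < b) (hτ : 0 < τ) :
    ∃ A : ℝ, 0 < A ∧ ∀ (ν : Measure ℝ) [IsProbabilityMeasure ν], SmoothError ν β c C ω₀ b τ →
      ∀ z : ℝ, Real.exp 1 ≤ z →
        (∀ x, |deconvKernel ν (bandwidth α β z) x| ≤ A * (z * rate α β z)) ∧
        ∀ μ ∈ sobolevClass α L, ∀ t₀ : ℝ,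
        ∫ y, deconvKernel ν (bandwidth α β z) (y - t₀) ^ 2 ∂(μ ∗ ν) ≤
          A * (z * rate α β z ^ 2) ∧
        |Real.pi / 2 - Real.pi * cdf μ t₀ -
          ∫ y, deconvKernel ν (bandwidth α β z) (y - t₀) ∂(μ ∗ ν)| ≤ A * rate α β z := by
  set w := min ω₀ 1 with hw
  have hw0 : 0 < w := lt_min hω₀ one_pos
  obtain ⟨A₀, hA₀, hV⟩ := exists_variance_le_rate (β := β) hα hw0 (min_le_right _ _)
  set K₀ := 4 + 2 * b * ((c ^ 2)⁻¹ * 2 ^ β) * τ⁻¹ with hK₀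
  set A₁ := K₀ + c⁻¹ * (1 + (w ^ 2)⁻¹) ^ (β / 2) * β⁻¹ with hA₁
  set A₂ := C / 2 * (2 * Real.pi * L ^ 2 + ∫ ω : ℝ, (1 + ω ^ 2) ^ (-(α + β))) *
    (c⁻¹ * (1 + (w ^ 2)⁻¹) ^ (β / 2)) ^ 2 with hA₂
  set A₃ := Real.pi * L ^ 2 + 2 ^ |α| / (2 * (2 * α + 1)) with hA₃
  have hα' : 0 < 2 * α + 1 := by linarith
  have hpi := Real.pi_pos
  have hK₀0 : 0 < K₀ := by positivity
  have hA₁0 : 0 < A₁ := by positivity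
  have hA₂0 : 0 ≤ A₂ := by
    have : 0 ≤ ∫ ω : ℝ, (1 + ω ^ 2) ^ (-(α + β)) := integral_nonneg fun ω => by positivity
    positivity
  have hA₃0 : 0 < A₃ := by positivity
  refine ⟨A₁ + (2 * K₀ ^ 2 + 2 * A₂) * A₀ + A₃, by positivity, ?_⟩
  intro ν _ H z hz
  have hz1 := one_le_of_exp_one_le hz
  have hr := rate_pos (α := α) (β := β) hz
  have hlam := one_le_bandwidth (β := β) hα hz1
  have hlow : 0 ≤ (2 * K₀ ^ 2 + 2 * A₂) * A₀ := by positivity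
  have hsup : ∀ x, |deconvKernel ν (bandwidth α β z) x| ≤ A₁ * (z * rate α β z) := fun x =>
    (H.abs_deconvKernel_le hβ hc hω₀ hb hτ x hw0 (min_le_right _ _) (min_le_left _ _)
      hlam).trans (mul_le_mul_of_nonneg_left (bandwidth_rpow_le_mul_rate hreg hz) hA₁0.le)
  refine ⟨fun x => (hsup x).trans ?_, fun μ hμ t₀ => ⟨?_, ?_⟩⟩
  · gcongr
    linarith
  · have h1 := H.integral_sq_deconvKernel_le (L := L) hβ hc hC hω₀ hb hτ hreg hμ hw0
      (min_le_right _ _) (min_le_left _ _) hlam t₀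
    rw [← mul_assoc (C / 2 * _), ← hA₂] at h1
    have h2 : 0 ≤ ∫ ω in w..bandwidth α β z, ω ^ (2 * β - 2) :=
      intervalIntegral.integral_nonneg ((min_le_right _ _).trans hlam) fun ω hω =>
        Real.rpow_nonneg (hw0.le.trans hω.1) _
    refine h1.trans ?_
    calc _ ≤ (2 * K₀ ^ 2 + 2 * A₂) * (1 + ∫ ω in w..bandwidth α β z, ω ^ (2 * β - 2)) := by
          nlinarith [mul_nonneg (sq_nonneg K₀) h2]
      _ ≤ (2 * K₀ ^ 2 + 2 * A₂) * (A₀ * (z * rate α β z ^ 2)) := by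
          gcongr
          exact hV z hz
      _ ≤ _ := by
          rw [← mul_assoc]
          gcongr
          linarith
  · have hp := (sobolevClass_spec hμ).1
    rw [H.integral_deconvKernel_conv hβ hc hω₀ hb hτ (by linarith) hsup]
    refine (abs_bias_le hα hμ t₀ hlam).trans ?_
    calc _ ≤ A₃ * rate α β z := by
          gcongr
          exact bandwidth_rpow_neg_le_rate hα hz
      _ ≤ _ := by
          gcongr
          linarith

/-- The error of the estimator splits into the bias and the centered empirical mean; the factor
`1 / π ≤ 1` is dropped. -/
theorem IsProbDensity.abs_invEstimator_sub_le {fζ : ℝ → ℝ} (hf : IsProbDensity fζ)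
    (t₀ lam m F : ℝ) {n : ℕ} (Y : Fin n → ℝ) :
    |invEstimator fζ t₀ lam Y - F| ≤ |-(Real.pi / 2 - Real.pi * F - m) +
      (1 / n * ∑ j, deconvKernel (densityLaw fζ) lam (Y j - t₀) - m)| := by
  have hpi := Real.pi_gt_three
  rw [hf.invEstimator_eq]
  set S := 1 / (n : ℝ) * ∑ j, deconvKernel (densityLaw fζ) lam (Y j - t₀)
  have e1 : 1 / 2 - 1 / Real.pi * S - F =
      -(1 / Real.pi) * (-(Real.pi / 2 - Real.pi * F - m) + (S - m)) := by
    field_simp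
    ring
  rw [e1, abs_mul, abs_neg, abs_of_pos (by positivity)]
  refine mul_le_of_le_one_left (abs_nonneg _) ?_
  rw [div_le_one (by linarith)]
  linarith

theorem quadRisk_le {fζ : ℝ → ℝ} (hf : IsProbDensity fζ) {cl : Set (Measure ℝ)} {A r t₀ lam : ℝ}
    {n : ℕ} (hn : 0 < n) (hA : 0 < A) (hr : 0 < r) (M : ℝ)
    (hM : ∀ x, |deconvKernel (densityLaw fζ) lam x| ≤ M)
    (hcl : ∀ μ ∈ cl, IsProbabilityMeasure μ ∧
      ∫ y, deconvKernel (densityLaw fζ) lam (y - t₀) ^ 2 ∂(μ ∗ densityLaw fζ) ≤ A * (n * r ^ 2) ∧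
      |Real.pi / 2 - Real.pi * cdf μ t₀ -
          ∫ y, deconvKernel (densityLaw fζ) lam (y - t₀) ∂(μ ∗ densityLaw fζ)| ≤ A * r) :
    quadRisk (n := n) (invEstimator fζ t₀ lam) (densityLaw fζ) t₀ cl ≤
      ENNReal.ofReal (2 * (A + 1) * r) := by
  have hν := hf.isProbabilityMeasure
  refine iSup₂_le fun μ hμ => ?_
  obtain ⟨hp, hV, hB⟩ := hcl μ hμ
  have hm := measurable_deconvKernel (ν := densityLaw fζ) lam
  have hn' : (0 : ℝ) < n := by exact_mod_cast hn
  set m := ∫ y, deconvKernel (densityLaw fζ) lam (y - t₀) ∂(μ ∗ densityLaw fζ) with hmdef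
  have h1 := lintegral_sq_mean_sub_le (P := μ ∗ densityLaw fζ)
    (G := fun y => deconvKernel (densityLaw fζ) lam (y - t₀)) (by fun_prop) (fun y => hM _) hV hn
    (-(Real.pi / 2 - Real.pi * cdf μ t₀ - m))
  have h2 : ∫⁻ y : Fin n → ℝ, ENNReal.ofReal (|invEstimator fζ t₀ lam y - cdf μ t₀| ^ 2)
      ∂(obsLaw μ (densityLaw fζ) n) ≤ ENNReal.ofReal (2 * (A + 1) * r) ^ 2 := by
    refine (lintegral_mono fun y => ENNReal.ofReal_le_ofReal (pow_le_pow_left₀ (abs_nonneg _)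
      (hf.abs_invEstimator_sub_le t₀ lam m (cdf μ t₀) y) 2)).trans (h1.trans ?_)
    rw [← ENNReal.ofReal_pow (by positivity)]
    refine ENNReal.ofReal_le_ofReal ?_
    have e1 : A * (n * r ^ 2) / n = A * r ^ 2 := by field_simp
    have e2 : (-(Real.pi / 2 - Real.pi * cdf μ t₀ - m)) ^ 2 ≤ (A * r) ^ 2 := by
      rw [neg_sq, ← sq_abs]
      gcongr
    rw [e1]
    nlinarith [mul_pos hA (pow_pos hr 2), pow_pos hr 2, sq_nonneg (A * r)]
  calc _ ≤ (ENNReal.ofReal (2 * (A + 1) * r) ^ 2) ^ (1 / 2 : ℝ) :=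
        ENNReal.rpow_le_rpow h2 (by norm_num)
    _ = _ := by
        rw [← ENNReal.rpow_natCast, ← ENNReal.rpow_mul]
        norm_num

theorem epsRisk_le {fζ : ℝ → ℝ} (hf : IsProbDensity fζ) {cl : Set (Measure ℝ)}
    {A r t₀ lam ε : ℝ} {n : ℕ} (hn : 0 < n) (hA : 0 < A) (hr : 0 < r) (hε : 0 < ε)
    (hlog : 0 < Real.log (2 / ε))
    (hM : ∀ x, |deconvKernel (densityLaw fζ) lam x| ≤ A * (n / Real.log (2 / ε) * r))
    (hcl : ∀ μ ∈ cl, IsProbabilityMeasure μ ∧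
      ∫ y, deconvKernel (densityLaw fζ) lam (y - t₀) ^ 2 ∂(μ ∗ densityLaw fζ) ≤
        A * (n / Real.log (2 / ε) * r ^ 2) ∧
      |Real.pi / 2 - Real.pi * cdf μ t₀ -
          ∫ y, deconvKernel (densityLaw fζ) lam (y - t₀) ∂(μ ∗ densityLaw fζ)| ≤ A * r) :
    epsRisk (n := n) ε (invEstimator fζ t₀ lam) (densityLaw fζ) t₀ cl ≤
      ENNReal.ofReal ((5 * A + 2 * Real.sqrt A) * r) := by
  have hν := hf.isProbabilityMeasure
  have hn' : (0 : ℝ) < n := by exact_mod_cast hn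
  refine sInf_le ?_
  rw [epsThresholds, mem_ofPred_eq]
  refine iSup₂_le fun μ hμ => ?_
  obtain ⟨hp, hV, hB⟩ := hcl μ hμ
  have hm := measurable_deconvKernel (ν := densityLaw fζ) lam
  set z := n / Real.log (2 / ε) with hz
  have hz0 : 0 < z := by positivity
  set m := ∫ y, deconvKernel (densityLaw fζ) lam (y - t₀) ∂(μ ∗ densityLaw fζ) with hmdef
  have h1 := measure_abs_mean_sub_gt_le (P := μ ∗ densityLaw fζ)
    (G := fun y => deconvKernel (densityLaw fζ) lam (y - t₀)) (by fun_prop) (fun y => hM _)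
    (by positivity) hV hn hz0
  have e1 : 2 * Real.exp (-(n / z)) = ε := by
    have : n / z = Real.log (2 / ε) := by
      rw [hz]
      field_simp
    rw [this, Real.exp_neg, Real.exp_log (by positivity)]
    field_simp
  have e2 : 2 * (2 * (A * (z * r)) / z + Real.sqrt (A * (z * r ^ 2) / z)) =
      (4 * A + 2 * Real.sqrt A) * r := by
    have e3 : A * (z * r ^ 2) / z = A * r ^ 2 := by field_simp
    rw [e3, Real.sqrt_mul hA.le, Real.sqrt_sq hr.le]
    field_simp
    ring
  rw [e1, e2] at h1
  have hsub : {y : Fin n → ℝ | ENNReal.ofReal ((5 * A + 2 * Real.sqrt A) * r) <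
      ENNReal.ofReal |invEstimator fζ t₀ lam y - cdf μ t₀|} ⊆
      {y | (4 * A + 2 * Real.sqrt A) * r <
        |1 / n * ∑ j, deconvKernel (densityLaw fζ) lam (y j - t₀) - m|} := by
    intro y hy
    have h2 : (5 * A + 2 * Real.sqrt A) * r < |invEstimator fζ t₀ lam y - cdf μ t₀| :=
      (ENNReal.ofReal_lt_ofReal_iff_of_nonneg (by positivity)).1 hy
    have h3 := hf.abs_invEstimator_sub_le t₀ lam m (cdf μ t₀) y
    have h4 := abs_add_le (-(Real.pi / 2 - Real.pi * cdf μ t₀ - m))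
      (1 / n * ∑ j, deconvKernel (densityLaw fζ) lam (y j - t₀) - m)
    rw [abs_neg] at h4
    simp only [mem_ofPred_eq]
    linarith
  refine (measure_mono hsub).trans ?_
  rw [obsLaw, ← ofReal_measureReal]
  exact ENNReal.ofReal_le_ofReal h1

end

theorem IsProbDensity.smoothError {fζ : ℝ → ℝ} {β c C ω₀ b τ : ℝ} (hf : IsProbDensity fζ)
    (h1 : OrdinarySmooth fζ β c C) (h2 : NearOrigin fζ ω₀ b τ) :
    SmoothError (densityLaw fζ) β c C ω₀ b τ where
  lower ω := by
    rw [← hf.fourierTr_eq_charFun]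
    exact (h1 ω).1
  upper ω := by
    rw [← hf.fourierTr_eq_charFun]
    exact (h1 ω).2
  near ω hω := by
    rw [← hf.fourierTr_eq_charFun]
    exact h2 ω hω

end Deconvolution

theorem theorem2p1 (α β L c C ω₀ b τ : ℝ)
    (hα : -(1 / 2) < α) (hβ : 0 < β) (hreg : 1 / 2 < α + β) (hL : 0 < L)
    (hc : 0 < c) (hC : 0 < C) (hω₀ : 0 < ω₀) (hb : 0 < b) (hτ : 0 < τ) :
    ∃ C₁ C₂ C₃ C₄ : ℝ, 0 < C₁ ∧ 0 < C₂ ∧ 0 < C₃ ∧ 0 < C₄ ∧ C₄ ≤ 1 ∧ ∃ n₀ : ℕ,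
      ∀ fζ : ℝ → ℝ, Deconvolution.IsProbDensity fζ →
        Deconvolution.OrdinarySmooth fζ β c C → Deconvolution.NearOrigin fζ ω₀ b τ →
        ∀ t₀ : ℝ,
          (∀ y lam : ℝ, 0 < lam →
            IntervalIntegrable (Deconvolution.invIntegrand fζ t₀ y) MeasureTheory.volume 0 lam) ∧
          ∀ n : ℕ, n₀ ≤ n →
            Deconvolution.quadRisk (n := n)
                (Deconvolution.invEstimator fζ t₀ (C₁ * Deconvolution.bandwidth α β n))
                (Deconvolution.densityLaw fζ) t₀ (Deconvolution.sobolevClass α L)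
              ≤ ENNReal.ofReal (C₂ * Deconvolution.rate α β n) ∧
            ∀ ε : ℝ, 0 < ε → ε < 1 / 2 → 2 * Real.exp (-C₄ * n) ≤ ε →
              Deconvolution.epsRisk (n := n) ε
                  (Deconvolution.invEstimator fζ t₀
                    (C₁ * Deconvolution.bandwidth α β (n / Real.log (2 / ε))))
                  (Deconvolution.densityLaw fζ) t₀ (Deconvolution.sobolevClass α L)
                ≤ ENNReal.ofReal (C₃ * Deconvolution.rate α β (n / Real.log (2 / ε))) := by
  obtain ⟨A, hA, hbounds⟩ :=
    Deconvolution.exists_kernel_bounds (L := L) hα hβ hreg hc hC hω₀ hb hτ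
  -- `C₄ = e⁻¹` forces `n / ln (2 / ε) ≥ e`, where the logarithm in the rate is at least one
  refine ⟨1, 2 * (A + 1), 5 * A + 2 * Real.sqrt A, Real.exp (-1), one_pos, by positivity,
    by positivity, Real.exp_pos _, Real.exp_le_one_iff.2 (by norm_num), 3, ?_⟩
  intro fζ hf hE1 hE2 t₀
  have hν := hf.isProbabilityMeasure
  have H := hf.smoothError hE1 hE2
  refine ⟨fun y lam hlam => ?_, fun n hn => ?_⟩
  · rw [hf.invIntegrand_eq]
    exact H.intervalIntegrable_deconvIntegrand hβ hc hω₀ hb hτ _ hlam.le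
  have hn0 : 0 < n := by omega
  have hn3 : (3 : ℝ) ≤ n := by exact_mod_cast hn
  have hne : Real.exp 1 ≤ n := by
    have := Real.exp_one_lt_d9
    linarith
  simp only [one_mul]
  refine ⟨?_, fun ε hε hε2 hεn => ?_⟩
  · exact Deconvolution.quadRisk_le hf hn0 hA (Deconvolution.rate_pos hne) _
      (hbounds _ H n hne).1 fun μ hμ =>
        ⟨(Deconvolution.sobolevClass_spec hμ).1, (hbounds _ H n hne).2 μ hμ t₀⟩
  · have hlog : 0 < Real.log (2 / ε) := Real.log_pos (by
      rw [lt_div_iff₀ hε]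
      linarith)
    have hlogle : Real.log (2 / ε) ≤ Real.exp (-1) * n := by
      have h1 : 2 / ε ≤ Real.exp (Real.exp (-1) * n) := by
        rw [div_le_iff₀ hε]
        rw [neg_mul, Real.exp_neg, ← div_eq_mul_inv, div_le_iff₀ (Real.exp_pos _)] at hεn
        linarith
      exact (Real.log_le_iff_le_exp (by positivity)).2 h1
    have hz : Real.exp 1 ≤ n / Real.log (2 / ε) := by
      rw [le_div_iff₀ hlog]
      refine (mul_le_mul_of_nonneg_left hlogle (Real.exp_pos 1).le).trans_eq ?_
      rw [← mul_assoc, ← Real.exp_add]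
      norm_num
    exact Deconvolution.epsRisk_le hf hn0 hA (Deconvolution.rate_pos hz) hε hlog
      (hbounds _ H _ hz).1 fun μ hμ =>
        ⟨(Deconvolution.sobolevClass_spec hμ).1, (hbounds _ H _ hz).2 μ hμ t₀⟩
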